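/- Let $J^1=\mathbb R^5$ with coordinates $(x,y,z,p,q)$, contact form $U=dz-p\,dx-q\,dy$ and contact distribution $\mathcal C=\{U=0\}$. Let $W\subset J^1$ be open and let $\omega$ be a smooth 2-form on $W$ whose Monge--Ampère equation $\mathcal E_\omega$ is parabolic: at each point of $W$, $\omega|_{\mathcal C}$ is not a multiple of $dU|_{\mathcal C}$, and there is exactly one real number $c$ for which $(\omega+c\,dU)|_{\mathcal C}$ is degenerate. The characteristic distribution $\mathcal D\subset\mathcal C$ is the (2-dimensional) radical of this degenerate form on $\mathcal C$. For a distribution $\mathcal P$ put $\mathcal P'=\mathcal P+[\mathcal P,\mathcal P]$, computed with smooth local sections, and $\mathcal P''=(\mathcal P')'$. Assume that $\mathcal D'$ has constant rank on $W$. A distribution is called integrable if near each point it is the common kernel $\{dF_1=\dots=dF_m=0\}$ of independent differentials of smooth functions. An integral surface is a smooth immersed surface in $J^1$ tangent to $\mathcal C$; it is a solution of $\mathcal E_\omega$ if $\omega$ vanishes on its tangent planes, and a solution of the first order equation $f=k$ if $f=k$ along it. On an open set $V\subset W$, a function $f$ is called regular if it is smooth and $df$, $U$ are linearly independent at every point of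 $V$. A (classical) intermediate integral of $\mathcal E_\omega$ on $V$ is a regular function $f$ on $V$ such that, for every $k\in\mathbb R$, each solution in $V$ of $f=k$ is a solution of $\mathcal E_\omega$. We say that $\mathcal E_\omega$ admits intermediate integrals if each point of $W$ has an open neighbourhood in $W$ on which there is an intermediate integral. Theorem. $\mathcal E_\omega$ admits intermediate integrals if and only if (1) $\mathcal D$ is integrable on $W$, or (2) $\mathcal D''$ is 4-dimensional at every point of $W$ and integrable on $W$. In case (1), near each point of $W$ there exist three first integrals $f_1,f_2,f_3$ of $\mathcal D$ with independent differentials; and for any such triple on an open set $V\subset W$, the intermediate integrals on $V$ are exactly the regular functions $f$ on $V$ that near each point of $V$ are of the form $f=\phi(f_1,f_2,f_3)$ with $\phi:\mathbb R^3\to\mathbb R$ smooth. In case (2), near each point of $W$ there exists a smooth function $f$ with $\mathcal D''=\{df=0\}$; and any such $f$ on an open set $V\subset W$ is an intermediate integral on $V$, and the intermediate integrals on $V$ are exactly the regular functions $g$ on $V$ that near each point of $V$ are of the form $g=\phi(f)$ with $\phi:\mathbb R\to\mathbb R$ smooth. -/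

import Mathlib

open scoped ContDiff Topology

/-- The space `J¹(τ)` of 1-jets of functions of two variables, with its contact coordinates
`(x, y, z, p, q)`, in this order. -/
abbrev J1 : Type := Fin 5 → ℝ

/-- The contact form `U = dz - p dx - q dy`. -/
noncomputable def contactForm (θ : J1) : J1 →L[ℝ] ℝ :=
  ContinuousLinearMap.proj (R := ℝ) (φ := fun _ : Fin 5 => ℝ) 2
    - θ 3 • ContinuousLinearMap.proj (R := ℝ) (φ := fun _ : Fin 5 => ℝ) 0
    - θ 4 • ContinuousLinearMap.proj (R := ℝ) (φ := fun _ : Fin 5 => ℝ) 1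

/-- The differential `dU = dx ∧ dp + dy ∧ dq` of the contact form (it has constant coefficients). -/
def dContactForm (v w : J1) : ℝ :=
  v 0 * w 3 - v 3 * w 0 + (v 1 * w 4 - v 4 * w 1)

/-- A field of tangent subspaces of `J¹(τ)`. -/
abbrev TangentField : Type := J1 → Submodule ℝ J1

/-- The contact distribution `𝒞 = {U = 0}`. -/
noncomputable def contactDistribution : TangentField :=
  fun θ => LinearMap.ker (contactForm θ : J1 →ₗ[ℝ] ℝ)

/-- Differential 2-forms on `J¹(τ)`. -/
abbrev TwoForm : Type := J1 → J1 [⋀^Fin 2]→L[ℝ] ℝ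

/-- The radical of the restriction of `ρ + c dU` to the contact space at `θ`. -/
def radicalOnContact (ρ : TwoForm) (c : ℝ) : TangentField := fun θ =>
  { carrier := {v | v ∈ contactDistribution θ ∧
      ∀ w ∈ contactDistribution θ, ρ θ ![v, w] + c * dContactForm v w = 0}
    zero_mem' := by
      refine ⟨Submodule.zero_mem _, fun w _ => ?_⟩
      have h : ρ θ ![0, w] = 0 := (ρ θ).map_coord_zero (m := ![0, w]) 0 rfl
      simp [h, dContactForm]
    add_mem' := by
      rintro a b ⟨ha, ha'⟩ ⟨hb, hb'⟩
      refine ⟨Submodule.add_mem _ ha hb, fun w hw => ?_⟩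
      have h : ρ θ ![a + b, w] = ρ θ ![a, w] + ρ θ ![b, w] :=
        ContinuousMultilinearMap.cons_add (ρ θ).toContinuousMultilinearMap ![w] a b
      have h1 := ha' w hw
      have h2 := hb' w hw
      simp only [dContactForm, Pi.add_apply] at h1 h2 ⊢
      rw [h]
      linear_combination h1 + h2
    smul_mem' := by
      rintro r a ⟨ha, ha'⟩
      refine ⟨Submodule.smul_mem _ r ha, fun w hw => ?_⟩
      have h : ρ θ ![r • a, w] = r * ρ θ ![a, w] :=
        ContinuousMultilinearMap.cons_smul (ρ θ).toContinuousMultilinearMap ![w] r a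
      have h1 := ha' w hw
      simp only [dContactForm, Pi.smul_apply, smul_eq_mul] at h1 ⊢
      rw [h]
      linear_combination r * h1 }

/-- The Monge-Ampère equation `ℰ_ρ` is parabolic on `W`: at each point `ρ` is not in the ideal
generated by `U` and `dU`, and precisely one of the forms `ρ + c dU` is degenerate on `𝒞`
(that is, the quadratic equation for `c` has a double root: its discriminant vanishes). -/
def IsParabolic (ρ : TwoForm) (W : Set J1) : Prop :=
  ∀ θ ∈ W,
    (∀ c : ℝ, ∃ v ∈ contactDistribution θ, ∃ w ∈ contactDistribution θ,
      ρ θ ![v, w] + c * dContactForm v w ≠ 0) ∧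
    ∃! c : ℝ, radicalOnContact ρ c θ ≠ ⊥

/-- The characteristic distribution of `ℰ_ρ`: the radical on `𝒞` of the degenerate form
`ρ + c dU`. In the parabolic case precisely one value of `c` contributes to the supremum, all
the other radicals being zero. -/
def characteristicDistribution (ρ : TwoForm) : TangentField :=
  fun θ => ⨆ c : ℝ, radicalOnContact ρ c θ

/-- `X` is a smooth local section of `P`, defined near `θ`. -/
def IsLocalSection (P : TangentField) (θ : J1) (X : J1 → J1) : Prop :=
  ∃ V : Set J1, IsOpen V ∧ θ ∈ V ∧ ContDiffOn ℝ ∞ X V ∧ ∀ η ∈ V, X η ∈ P η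

/-- The derived distribution `P' = P + [P, P]`. -/
def derivedDistribution (P : TangentField) : TangentField := fun θ =>
  P θ ⊔ Submodule.span ℝ {u | ∃ X Y : J1 → J1, IsLocalSection P θ X ∧ IsLocalSection P θ Y ∧
    u = VectorField.lieBracket ℝ X Y θ}

/-- `P` is (completely) integrable on `W`: near each point it is tangent to the fibres of a
smooth submersion, that is `P = {dF₁ = ⋯ = dFₘ = 0}` with independent `dF₁, …, dFₘ`. -/
def IsIntegrableOn (P : TangentField) (W : Set J1) : Prop :=
  ∀ a ∈ W, ∃ V : Set J1, IsOpen V ∧ a ∈ V ∧ V ⊆ W ∧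
    ∃ (m : ℕ) (F : J1 → Fin m → ℝ), ContDiffOn ℝ ∞ F V ∧
      ∀ θ ∈ V, Function.Surjective (fderiv ℝ F θ) ∧
        P θ = LinearMap.ker (fderiv ℝ F θ : J1 →ₗ[ℝ] (Fin m → ℝ))

/-- `σ`, defined on the open set `O` of the plane, parametrizes a smooth immersed integral surface
of the contact distribution in `V`. Such surfaces are integral manifolds of maximal dimension. -/
structure IsIntegralSurface (V : Set J1) (O : Set (Fin 2 → ℝ)) (σ : (Fin 2 → ℝ) → J1) :
    Prop where
  isOpen : IsOpen O
  smooth : ContDiffOn ℝ ∞ σ O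
  mapsTo : ∀ u ∈ O, σ u ∈ V
  immersion : ∀ u ∈ O, Function.Injective (fderiv ℝ σ u)
  tangent : ∀ u ∈ O, ∀ v, fderiv ℝ σ u v ∈ contactDistribution (σ u)

/-- `σ` is a (generalized) solution in `V` of the first order equation `f = k`. -/
def IsSolutionOfLevel (f : J1 → ℝ) (k : ℝ) (V : Set J1) (O : Set (Fin 2 → ℝ))
    (σ : (Fin 2 → ℝ) → J1) : Prop :=
  IsIntegralSurface V O σ ∧ ∀ u ∈ O, f (σ u) = k

/-- `σ` is a (generalized) solution in `V` of the Monge-Ampère equation `ℰ_ρ`, i.e. an integral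
surface of the exterior differential system `{U = 0, ρ = 0}`. -/
def IsSolutionOfMAE (ρ : TwoForm) (V : Set J1) (O : Set (Fin 2 → ℝ))
    (σ : (Fin 2 → ℝ) → J1) : Prop :=
  IsIntegralSurface V O σ ∧
    ∀ u ∈ O, ∀ v w, ρ (σ u) ![fderiv ℝ σ u v, fderiv ℝ σ u w] = 0

/-- `f` is smooth on `V` and `df`, `U` are independent at each point of `V`, so that the
equations `f = k` are regular first order equations, i.e. the hamiltonian field of `f` has no
zeros. -/
def IsRegularFunction (f : J1 → ℝ) (V : Set J1) : Prop :=
  ContDiffOn ℝ ∞ f V ∧ ∀ θ ∈ V, LinearIndependent ℝ ![contactForm θ, fderiv ℝ f θ]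

/-- `f` is a (classical) intermediate integral of `ℰ_ρ` on `V`: the solutions of the regular first
order equations `f = k` are also solutions of `ℰ_ρ`. -/
def IsIntermediateIntegral (ρ : TwoForm) (V : Set J1) (f : J1 → ℝ) : Prop :=
  IsRegularFunction f V ∧
    ∀ (k : ℝ) (O : Set (Fin 2 → ℝ)) (σ : (Fin 2 → ℝ) → J1),
      IsSolutionOfLevel f k V O σ → IsSolutionOfMAE ρ V O σ

/-- `ℰ_ρ` admits intermediate integrals (locally, near each point of `W`). -/
def AdmitsIntermediateIntegrals (ρ : TwoForm) (W : Set J1) : Prop :=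
  ∀ a ∈ W, ∃ V : Set J1, IsOpen V ∧ a ∈ V ∧ V ⊆ W ∧ ∃ f : J1 → ℝ, IsIntermediateIntegral ρ V f

/-- The components of `F` are three independent first integrals of `P` on `V`. -/
def AreIndependentFirstIntegrals (P : TangentField) (V : Set J1) (F : J1 → Fin 3 → ℝ) : Prop :=
  (∀ i, ContDiffOn ℝ ∞ (fun θ => F θ i) V) ∧
    (∀ i, ∀ θ ∈ V, ∀ v ∈ P θ, fderiv ℝ (fun η => F η i) θ v = 0) ∧
    ∀ θ ∈ V, LinearIndependent ℝ (fun i => fderiv ℝ (fun η => F η i) θ)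

/-- Near each point of `V` one has `g = φ ∘ F` for some smooth function `φ`. -/
def IsLocallyFunctionOf {G : Type} [NormedAddCommGroup G] [NormedSpace ℝ G]
    (g : J1 → ℝ) (F : J1 → G) (V : Set J1) : Prop :=
  ∀ a ∈ V, ∃ φ : G → ℝ, ContDiff ℝ ∞ φ ∧ ∀ᶠ θ in 𝓝 a, g θ = φ (F θ)

/-- `f` is smooth on `V` and `P = {df = 0}` there. -/
def IsKernelOfDifferential (P : TangentField) (V : Set J1) (f : J1 → ℝ) : Prop :=
  ContDiffOn ℝ ∞ f V ∧ ∀ θ ∈ V, P θ = LinearMap.ker (fderiv ℝ f θ : J1 →ₗ[ℝ] ℝ)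

/-- `P` is 4-dimensional and integrable on `W`. -/
def IsFourDimIntegrableOn (P : TangentField) (W : Set J1) : Prop :=
  (∀ θ ∈ W, Module.finrank ℝ (P θ) = 4) ∧ IsIntegrableOn P W

/-! On the contact distribution 𝒞 the form dU is symplectic. The Pfaffian of `ρ + c dU` on 𝒞 is
quadratic in c with leading coefficient -1, so in the parabolic case it has a double root, and the
radical 𝒟 at that root turns out to be Lagrangian (`IsParabolic.isotropic`,
`IsParabolic.mem_of_orthogonal`).

Let X_f be the field in 𝒞 with dU(X_f, ·) = df on 𝒞. The pivot is that intermediate integrals are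
exactly the regular first integrals of 𝒟 (`IsParabolic.isIntermediateIntegral_iff`). If df kills 𝒟,
then X_f lies in 𝒟. A solution of f = k has a Lagrangian tangent plane T on which df vanishes, so
X_f lies in T as well; then ρ(X_f, ·) = -c df = 0 on T, and ρ vanishes on the 2-plane T. Conversely,
the method of characteristics (`exists_solutionOfLevel`) gives solutions of f = k tangent to X_f and
to any prescribed w in 𝒞 with df(w) = 0. Hence ρ(X_f, ·) is a multiple of df = dU(X_f, ·) on 𝒞, so
X_f is in 𝒟, and df = dU(X_f, ·) vanishes on the isotropic 𝒟.

It remains to count first integrals, which also kill 𝒟' and 𝒟''. Since U([X, Y]) = -dU(X, Y) on 𝒞,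
isotropy gives 𝒟' ⊂ 𝒞. If moreover 𝒟'' ⊂ 𝒞 at a point, then 𝒟' is skew-orthogonal to 𝒟 there, so 𝒟'
= 𝒟 (`IsParabolic.derivedDistribution_le_of_contact`). When 𝒟' has rank 2, Frobenius applies and
gives three first integrals, not all with differential proportional to U. When its rank is at least
3, 𝒟'' is strictly larger than 𝒟' and lies in ker df for any intermediate integral f, so it is the
4-dimensional space ker df. In case (2) the function f defining 𝒟'' is regular because constancy of
the rank of 𝒟' excludes 𝒟'' ⊂ 𝒞. A function whose differential kills ker dF is locally a function of
the submersion F. -/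

/-! ### Cut-offs and the smooth inverse function theorem. -/

section Analysis

variable {E F : Type} [NormedAddCommGroup E] [NormedSpace ℝ E] [NormedAddCommGroup F]
  [NormedSpace ℝ F]

/-- A function smooth near a point agrees near that point with a globally smooth function. -/
theorem exists_contDiff_eventuallyEq [FiniteDimensional ℝ E] {f : E → F} {U : Set E} {a : E}
    (hU : U ∈ 𝓝 a) (hf : ContDiffOn ℝ ∞ f U) :
    ∃ g : E → F, ContDiff ℝ ∞ g ∧ g =ᶠ[𝓝 a] f := by
  obtain ⟨V, hVU, hV, haV⟩ := mem_nhds_iff.1 hU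
  obtain ⟨d, hd, hdV⟩ := Euclidean.nhds_basis_closedBall.mem_iff.1 (hV.mem_nhds haV)
  let c : ContDiffBump (toEuclidean a) := ⟨d / 2, d, half_pos hd, half_lt_self hd⟩
  have hc : ContDiff ℝ ∞ (fun x : E => c (toEuclidean x)) :=
    c.contDiff.comp toEuclidean.contDiff
  refine ⟨fun x => c (toEuclidean x) • f x, ?_, ?_⟩
  · refine contDiff_iff_contDiffAt.2 fun x => ?_
    by_cases hx : x ∈ V
    · exact hc.contDiffAt.smul ((hf.mono hVU).contDiffAt (hV.mem_nhds hx))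
    · have : ∀ᶠ y in 𝓝 x, c (toEuclidean y) • f y = 0 := by
        have hx' : x ∈ (Euclidean.closedBall a d)ᶜ := fun h => hx (hdV h)
        filter_upwards [Euclidean.isClosed_closedBall.isOpen_compl.mem_nhds hx'] with y hy
        have : c (toEuclidean y) = 0 := c.zero_of_le_dist (le_of_lt (not_le.1 hy))
        rw [this, zero_smul]
      exact (contDiffAt_const (c := (0 : F))).congr_of_eventuallyEq this
  · have : toEuclidean ⁻¹' Metric.ball (toEuclidean a) (d / 2) ∈ 𝓝 a :=
      toEuclidean.continuous.continuousAt.preimage_mem_nhds (Metric.ball_mem_nhds _ (half_pos hd))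
    filter_upwards [this] with y hy
    rw [c.one_of_mem_closedBall (Metric.ball_subset_closedBall hy), one_smul]

/-- The inverse function theorem for smooth maps on open sets. -/
theorem exists_smooth_local_inverse [CompleteSpace E] {f : E → F} {U : Set E} (hU : IsOpen U)
    (hf : ContDiffOn ℝ ∞ f U) {a : E} (ha : a ∈ U) (h : (fderiv ℝ f a).IsInvertible) :
    ∃ e : OpenPartialHomeomorph E F, a ∈ e.source ∧ e.source ⊆ U ∧ ⇑e = f ∧
      (∀ x ∈ e.source, (fderiv ℝ f x).IsInvertible) ∧ ContDiffOn ℝ ∞ e.symm e.target := by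
  obtain ⟨f', hf'⟩ := h
  have hcd : ContDiffAt ℝ ∞ f a := hf.contDiffAt (hU.mem_nhds ha)
  have hd : HasFDerivAt f (f' : E →L[ℝ] F) a := by
    rw [hf']; exact (hcd.differentiableAt (by simp)).hasFDerivAt
  let e₀ := hcd.toOpenPartialHomeomorph f hd (by simp)
  have hcont : ContinuousOn (fderiv ℝ f) U := hf.continuousOn_fderiv_of_isOpen hU (by simp)
  -- Smoothness of the inverse at each target point needs an invertible derivative at its preimage,
  -- so the source is cut down to this open set.
  have hopen : IsOpen (U ∩ fderiv ℝ f ⁻¹' Set.range ((↑) : (E ≃L[ℝ] F) → E →L[ℝ] F)) :=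
    hcont.isOpen_inter_preimage hU ContinuousLinearEquiv.isOpen
  refine ⟨e₀.restrOpen _ hopen, ?_, ?_, rfl, ?_, ?_⟩
  · rw [OpenPartialHomeomorph.restrOpen_source]
    exact ⟨hcd.mem_toOpenPartialHomeomorph_source hd (by simp), ha, f', hf'⟩
  · rw [OpenPartialHomeomorph.restrOpen_source]
    exact fun x hx => hx.2.1
  · rw [OpenPartialHomeomorph.restrOpen_source]
    exact fun x hx => hx.2.2
  · intro y hy
    have hx := (e₀.restrOpen _ hopen).map_target hy
    rw [OpenPartialHomeomorph.restrOpen_source] at hx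
    obtain ⟨-, hxU, g', hg'⟩ := hx
    have hcx := hf.contDiffAt (hU.mem_nhds hxU)
    refine ((e₀.restrOpen _ hopen).contDiffAt_symm (f₀' := g') hy ?_ hcx).contDiffWithinAt
    rw [hg']
    exact (hcx.differentiableAt (by simp)).hasFDerivAt

end Analysis

/-! ### Smoothness of composition operators on spaces of continuous functions. -/

section Nemytskii

variable {K : Type} [TopologicalSpace K] [CompactSpace K]
variable {E F : Type} [NormedAddCommGroup E] [NormedSpace ℝ E] [NormedAddCommGroup F]
  [NormedSpace ℝ F]

/-- Pointwise application of a continuous family of operators to a continuous function. -/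
noncomputable def pointwiseApplyCLM :
    C(K, E →L[ℝ] F) →L[ℝ] C(K, E) →L[ℝ] C(K, F) :=
  LinearMap.mkContinuous₂
    (LinearMap.mk₂ ℝ (fun (A : C(K, E →L[ℝ] F)) (u : C(K, E)) =>
      (⟨fun t => A t (u t), A.continuous.clm_apply u.continuous⟩ : C(K, F)))
      (fun _ _ _ => by ext; simp) (fun _ _ _ => by ext; simp)
      (fun _ _ _ => by ext; simp) (fun _ _ _ => by ext; simp)) 1
    (fun A u => by
      rw [ContinuousMap.norm_le _ (by positivity)]
      intro t
      simp only [LinearMap.mk₂_apply, ContinuousMap.coe_mk, one_mul]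
      exact ((A t).le_opNorm _).trans
        (mul_le_mul (A.norm_coe_le_norm t) (u.norm_coe_le_norm t) (norm_nonneg _) (by positivity)))

@[simp]
theorem pointwiseApplyCLM_apply (A : C(K, E →L[ℝ] F)) (u : C(K, E)) (t : K) :
    pointwiseApplyCLM A u t = A t (u t) := rfl

/-- The derivative of f is uniformly continuous around the compact image of α, so the mean value
inequality bounds the remainder uniformly in t. -/
theorem hasFDerivAt_postcomp {f : E → F} (hf : ContDiff ℝ 1 f) (α : C(K, E)) :
    HasFDerivAt (fun α : C(K, E) => (⟨f, hf.continuous⟩ : C(E, F)).comp α)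
      (pointwiseApplyCLM
        ((⟨fderiv ℝ f, hf.continuous_fderiv one_ne_zero⟩ : C(E, E →L[ℝ] F)).comp α)) α := by
  rw [hasFDerivAt_iff_isLittleO_nhds_zero, Asymptotics.isLittleO_iff]
  intro ε hε
  have hK : IsCompact (Set.range α) := isCompact_range α.continuous
  have huc := hK.uniformContinuousAt_of_continuousAt (fderiv ℝ f)
    (fun x _ => (hf.continuous_fderiv one_ne_zero).continuousAt) (Metric.dist_mem_uniformity hε)
  obtain ⟨δ, hδ, hδ'⟩ := Metric.mem_uniformity_dist.1 huc
  filter_upwards [Metric.ball_mem_nhds (0 : C(K, E)) hδ] with h hh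
  rw [ContinuousMap.norm_le _ (by positivity)]
  intro t
  have hht : ‖h t‖ < δ := (h.norm_coe_le_norm t).trans_lt (by simpa using hh)
  have := (convex_ball (α t) δ).norm_image_sub_le_of_norm_fderiv_le' (f := f)
    (φ := fderiv ℝ f (α t)) (C := ε) (x := α t) (y := α t + h t)
    (fun x _ => hf.differentiable one_ne_zero x)
    (fun x hx => by
      have := hδ' (a := α t) (b := x) (by rw [dist_comm]; exact hx) ⟨t, rfl⟩
      rw [← dist_eq_norm, dist_comm]
      exact le_of_lt this)
    (Metric.mem_ball_self hδ) (by simpa using hht)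
  simp only [add_sub_cancel_left] at this
  refine (le_of_eq ?_).trans (this.trans
    (mul_le_mul_of_nonneg_left (h.norm_coe_le_norm t) hε.le))
  simp

/-- Composition with a smooth function is a smooth map between spaces of continuous functions. -/
theorem contDiff_postcomp_nat (n : ℕ) : ∀ {F : Type} [NormedAddCommGroup F] [NormedSpace ℝ F]
    {f : E → F} (hf : ContDiff ℝ ∞ f),
    ContDiff ℝ n (fun α : C(K, E) => (⟨f, hf.continuous⟩ : C(E, F)).comp α) := by
  induction n with
  | zero =>
    intro F _ _ f hf
    exact contDiff_zero.2 (ContinuousMap.continuous_postcomp _)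
  | succ n ih =>
    intro F _ _ f hf
    have h1 : ContDiff ℝ 1 f := hf.of_le (by simp)
    have hd := hasFDerivAt_postcomp (K := K) h1
    have hf' : ContDiff ℝ ∞ (fderiv ℝ f) := hf.fderiv_right (by simp)
    rw [Nat.cast_add, Nat.cast_one, contDiff_succ_iff_fderiv]
    refine ⟨fun α => (hd α).differentiableAt, by simp, ?_⟩
    -- The derivative is again a composition operator, now for `fderiv ℝ f`, followed by a fixed
    -- continuous linear map. The target changes, which is why the induction quantifies over `F`.
    have : fderiv ℝ (fun α : C(K, E) => (⟨f, hf.continuous⟩ : C(E, F)).comp α) = fun α =>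
        pointwiseApplyCLM ((⟨fderiv ℝ f, hf'.continuous⟩ : C(E, E →L[ℝ] F)).comp α) :=
      funext fun α => (hd α).fderiv
    rw [this]
    exact (pointwiseApplyCLM (K := K) (E := E) (F := F)).contDiff.comp (ih hf')

theorem contDiff_postcomp {f : E → F} (hf : ContDiff ℝ ∞ f) :
    ContDiff ℝ ∞ (fun α : C(K, E) => (⟨f, hf.continuous⟩ : C(E, F)).comp α) :=
  contDiff_infty.2 fun n => contDiff_postcomp_nat n hf

end Nemytskii

/-! ### Smooth local flows, by the inverse function theorem in a space of curves. -/

section Flow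

variable {E : Type} [NormedAddCommGroup E] [NormedSpace ℝ E]

/-- The operator `α ↦ (t ↦ ∫ s in 0..t, α s)` on continuous functions on the unit interval. -/
noncomputable def primitiveCLM : C(unitInterval, E) →L[ℝ] C(unitInterval, E) :=
  LinearMap.mkContinuous
    { toFun := fun α => ⟨fun t => ∫ s in (0 : ℝ)..t, α (Set.projIcc 0 1 zero_le_one s),
        (intervalIntegral.continuous_primitive (fun _ _ =>
          (α.continuous.comp continuous_projIcc).intervalIntegrable _ _) 0).comp
          continuous_subtype_val⟩
      map_add' := fun α β => by
        ext t
        simp only [ContinuousMap.coe_mk, ContinuousMap.add_apply]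
        exact intervalIntegral.integral_add
          ((α.continuous.comp continuous_projIcc).intervalIntegrable _ _)
          ((β.continuous.comp continuous_projIcc).intervalIntegrable _ _)
      map_smul' := fun c α => by
        ext t
        simp only [ContinuousMap.coe_mk, ContinuousMap.smul_apply, RingHom.id_apply]
        exact intervalIntegral.integral_smul _ _ } 1
    (fun α => by
      rw [ContinuousMap.norm_le _ (by positivity), one_mul]
      intro t
      simp only [LinearMap.coe_mk, AddHom.coe_mk, ContinuousMap.coe_mk]
      refine (intervalIntegral.norm_integral_le_of_norm_le_const
        fun s _ => α.norm_coe_le_norm _).trans ?_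
      rw [sub_zero, abs_of_nonneg t.2.1]
      exact mul_le_of_le_one_right (norm_nonneg _) t.2.2)

theorem primitiveCLM_apply (α : C(unitInterval, E)) (t : unitInterval) :
    primitiveCLM α t = ∫ s in (0 : ℝ)..t, α (Set.projIcc 0 1 zero_le_one s) := rfl

variable {X : E → E}

/-- The map whose zero in the last component expresses the integral equation of the curves
`t ↦ Φ (c * t, x)`, where `Φ` is the flow of `X`. -/
noncomputable def flowEquation (hX : ContDiff ℝ ∞ X) (p : ℝ × E × C(unitInterval, E)) :
    ℝ × E × C(unitInterval, E) :=
  (p.1, p.2.1, p.2.2 - ContinuousLinearMap.const ℝ unitInterval p.2.1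
    - p.1 • primitiveCLM ((⟨X, hX.continuous⟩ : C(E, E)).comp p.2.2))

theorem contDiff_flowEquation (hX : ContDiff ℝ ∞ X) : ContDiff ℝ ∞ (flowEquation hX) := by
  have h : ContDiff ℝ ∞ (fun p : ℝ × E × C(unitInterval, E) =>
      (⟨X, hX.continuous⟩ : C(E, E)).comp p.2.2) :=
    (contDiff_postcomp hX).comp (contDiff_snd.comp contDiff_snd)
  have h' := (primitiveCLM (E := E)).contDiff.comp h
  have h2 := (ContinuousLinearMap.const ℝ (M := E) unitInterval).contDiff.comp
    (contDiff_fst.comp contDiff_snd : ContDiff ℝ ∞ fun p : ℝ × E × C(unitInterval, E) => p.2.1)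
  exact contDiff_fst.prodMk ((contDiff_fst.comp contDiff_snd).prodMk
    (((contDiff_snd.comp contDiff_snd).sub h2).sub (contDiff_fst.smul h')))

theorem fderiv_flowEquation_apply (hX : ContDiff ℝ ∞ X) (p v : ℝ × E × C(unitInterval, E)) :
    fderiv ℝ (flowEquation hX) p v = (v.1, v.2.1,
      v.2.2 - ContinuousLinearMap.const ℝ unitInterval v.2.1
      - (p.1 • primitiveCLM (pointwiseApplyCLM
          ((⟨fderiv ℝ X, hX.continuous_fderiv (by simp)⟩ : C(E, E →L[ℝ] E)).comp p.2.2) v.2.2)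
        + v.1 • primitiveCLM ((⟨X, hX.continuous⟩ : C(E, E)).comp p.2.2))) := by
  have h1 : HasFDerivAt (fun p : ℝ × E × C(unitInterval, E) => p.1)
    (ContinuousLinearMap.fst ℝ ℝ (E × C(unitInterval, E))) p := hasFDerivAt_fst
  have h2 : HasFDerivAt (fun p : ℝ × E × C(unitInterval, E) => p.2)
    (ContinuousLinearMap.snd ℝ ℝ (E × C(unitInterval, E))) p := hasFDerivAt_snd
  have h21 := h2.fst
  have h22 := h2.snd
  have hN := (primitiveCLM (E := E)).hasFDerivAt.comp p
    ((hasFDerivAt_postcomp (hX.of_le (by simp)) p.2.2).comp p h22)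
  have hc := (ContinuousLinearMap.const ℝ (M := E) unitInterval).hasFDerivAt.comp p h21
  have := h1.prodMk (h21.prodMk ((h22.sub hc).sub (h1.smul hN)))
  have h3 : HasFDerivAt (flowEquation hX) _ p := this
  rw [h3.fderiv]
  rfl

/-- At c = 0 the integral term contributes only through the variation of c, so the derivative is
triangular with identity diagonal and is inverted by changing signs. -/
theorem isInvertible_fderiv_flowEquation (hX : ContDiff ℝ ∞ X) (x : E)
    (α : C(unitInterval, E)) :
    (fderiv ℝ (flowEquation hX) (0, x, α)).IsInvertible := by
  let b := primitiveCLM ((⟨X, hX.continuous⟩ : C(E, E)).comp α)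
  let g : ℝ × E × C(unitInterval, E) →L[ℝ] ℝ × E × C(unitInterval, E) :=
    (ContinuousLinearMap.fst ℝ _ _).prod
      (((ContinuousLinearMap.fst ℝ _ _).comp (ContinuousLinearMap.snd ℝ _ _)).prod
        (((ContinuousLinearMap.snd ℝ _ _).comp (ContinuousLinearMap.snd ℝ _ _))
          + (ContinuousLinearMap.const ℝ unitInterval).comp
            ((ContinuousLinearMap.fst ℝ _ _).comp (ContinuousLinearMap.snd ℝ _ _))
          + (ContinuousLinearMap.fst ℝ _ _).smulRight b))
  have hg : ∀ v, g v = (v.1, v.2.1,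
      v.2.2 + ContinuousLinearMap.const ℝ unitInterval v.2.1 + v.1 • b) := fun v => rfl
  refine ⟨ContinuousLinearEquiv.equivOfInverse (fderiv ℝ (flowEquation hX) (0, x, α)) g ?_ ?_, ?_⟩
  · rintro ⟨c, y, β⟩
    rw [fderiv_flowEquation_apply, hg]
    simp [b]
    abel
  · rintro ⟨c, y, β⟩
    rw [fderiv_flowEquation_apply, hg]
    simp [b]
    abel
  · rfl

/-- A curve solving the integral equation satisfies the equation obtained by differentiating in
the time parameter. -/
theorem smul_comp_eq_primitiveCLM [CompleteSpace E] (hX : ContDiff ℝ ∞ X) {c : ℝ} {x : E}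
    {α β : C(unitInterval, E)}
    (hα : α = ContinuousLinearMap.const ℝ unitInterval x
      + c • primitiveCLM ((⟨X, hX.continuous⟩ : C(E, E)).comp α))
    (hβ : ∀ t, β t = (t : ℝ) • X (α t)) :
    β = primitiveCLM ((⟨X, hX.continuous⟩ : C(E, E)).comp α) +
      c • primitiveCLM (pointwiseApplyCLM
          ((⟨fderiv ℝ X, hX.continuous_fderiv (by simp)⟩ : C(E, E →L[ℝ] E)).comp α) β) := by
  let pr : ℝ → unitInterval := Set.projIcc 0 1 zero_le_one
  have hprc : Continuous pr := continuous_projIcc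
  -- An extension of α to the whole line, which can be differentiated at the end points too.
  let γ : ℝ → E := fun s => x + c • ∫ r in (0 : ℝ)..s, X (α (pr r))
  have hXc : Continuous fun r => X (α (pr r)) := hX.continuous.comp (α.continuous.comp hprc)
  have hγ : ∀ s, HasDerivAt γ (c • X (α (pr s))) s := fun s =>
    ((hXc.integral_hasStrictDerivAt 0 s).hasDerivAt.const_smul c).const_add x
  have hγα : ∀ t : unitInterval, γ t = α t := by
    intro t
    conv_rhs => rw [hα]
    rfl
  have hpr : ∀ t : unitInterval, pr t = t := fun t => Set.projIcc_val zero_le_one t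
  have hXd : ∀ y, HasFDerivAt X (fderiv ℝ X y) y := fun y =>
    (hX.differentiable (by simp) y).hasFDerivAt
  -- The claim is the fundamental theorem of calculus for s ↦ s X(γ(s)), which equals β on the unit
  -- interval and vanishes at 0.
  have hderiv : ∀ s, HasDerivAt (fun s => s • X (γ s))
      (s • fderiv ℝ X (γ s) (c • X (α (pr s))) + (1 : ℝ) • X (γ s)) s := fun s =>
    (hasDerivAt_id s).smul ((hXd (γ s)).comp_hasDerivAt s (hγ s))
  have hγc : Continuous γ := continuous_iff_continuousAt.2 fun s => (hγ s).continuousAt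
  have hf'c := hX.continuous_fderiv (n := ∞) (by simp)
  ext t
  have hint := intervalIntegral.integral_eq_sub_of_hasDerivAt (a := 0) (b := t)
    (fun s _ => hderiv s) (by
      apply Continuous.intervalIntegrable
      have := (hf'c.comp hγc).clm_apply (hXc.const_smul c)
      exact (continuous_id.smul this).add ((hX.continuous.comp hγc).const_smul (1 : ℝ)))
  have hcongr : ∫ s in (0 : ℝ)..t,
      (s • fderiv ℝ X (γ s) (c • X (α (pr s))) + (1 : ℝ) • X (γ s)) =
      ∫ s in (0 : ℝ)..t, (c • fderiv ℝ X (α (pr s)) (β (pr s)) + X (α (pr s))) := by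
    refine intervalIntegral.integral_congr fun s hs => ?_
    rw [Set.uIcc_of_le t.2.1] at hs
    have hs1 : s ∈ Set.Icc (0 : ℝ) 1 := ⟨hs.1, hs.2.trans t.2.2⟩
    have h1 : γ s = α (pr s) := by
      rw [show pr s = ⟨s, hs1⟩ from hpr ⟨s, hs1⟩]
      exact hγα ⟨s, hs1⟩
    have h2 : ((pr s : unitInterval) : ℝ) = s := by rw [hpr ⟨s, hs1⟩]
    simp only [h1, hβ, h2, map_smul, one_smul]
    rw [smul_comm]
  rw [hcongr, intervalIntegral.integral_add, intervalIntegral.integral_smul] at hint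
  · simp only [ContinuousMap.add_apply, ContinuousMap.smul_apply, primitiveCLM_apply]
    rw [hβ, ← hγα]
    rw [zero_smul, sub_zero] at hint
    rw [← hint, add_comm]
    rfl
  · exact ((hf'c.comp (α.continuous.comp hprc)).clm_apply
      (β.continuous.comp hprc)).const_smul c |>.intervalIntegrable _ _
  · exact hXc.intervalIntegrable _ _

/-- Smooth local flow of a globally defined smooth vector field. -/
theorem exists_smooth_flow_of_contDiff [CompleteSpace E] (hX : ContDiff ℝ ∞ X) (x₀ : E) :
    ∃ (Φ : ℝ × E → E) (U : Set (ℝ × E)), IsOpen U ∧ (0, x₀) ∈ U ∧ ContDiffOn ℝ ∞ Φ U ∧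
      (∀ p ∈ U, fderiv ℝ Φ p (1, 0) = X (Φ p)) ∧ ∀ x, (0, x) ∈ U → Φ (0, x) = x := by
  obtain ⟨e, hae, -, hef, hinv, hsymm⟩ := exists_smooth_local_inverse isOpen_univ
    (contDiff_flowEquation hX).contDiffOn (a := (0, x₀, ContinuousLinearMap.const ℝ _ x₀))
    (Set.mem_univ _) (isInvertible_fderiv_flowEquation hX x₀ _)
  -- The local inverse of `flowEquation` at (c, x, 0) is (c, x, α), with α the solution of α' = c
  -- X(α), α(0) = x.
  let ι : ℝ × E → ℝ × E × C(unitInterval, E) := fun p => (p.1, p.2, 0)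
  have hι : ContDiff ℝ ∞ ι := contDiff_fst.prodMk (contDiff_snd.prodMk contDiff_const)
  let A : ℝ × E → C(unitInterval, E) := fun p => (e.symm (ι p)).2.2
  have hU : IsOpen (ι ⁻¹' e.target) := e.open_target.preimage hι.continuous
  have hAs : ContDiffOn ℝ ∞ A (ι ⁻¹' e.target) :=
    (contDiff_snd.comp contDiff_snd).comp_contDiffOn
      (hsymm.comp hι.contDiffOn (Set.mapsTo_preimage _ _))
  have key : ∀ p ∈ ι ⁻¹' e.target, e.symm (ι p) = (p.1, p.2, A p) ∧
      A p = ContinuousLinearMap.const ℝ unitInterval p.2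
        + p.1 • primitiveCLM ((⟨X, hX.continuous⟩ : C(E, E)).comp (A p)) := by
    intro p hp
    have h := e.right_inv hp
    rw [hef] at h
    have h1 : (e.symm (ι p)).1 = p.1 := congrArg Prod.fst h
    have h2 : (e.symm (ι p)).2.1 = p.2 := congrArg (fun q => q.2.1) h
    have h3 := congrArg (fun q => q.2.2) h
    simp only [flowEquation, ι] at h3
    change A p - ContinuousLinearMap.const ℝ unitInterval (e.symm (ι p)).2.1 -
      (e.symm (ι p)).1 • primitiveCLM ((⟨X, hX.continuous⟩ : C(E, E)).comp (A p)) = 0 at h3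
    rw [h1, h2] at h3
    refine ⟨Prod.ext h1 (Prod.ext h2 rfl), ?_⟩
    rw [sub_sub, sub_eq_zero] at h3
    exact h3
  -- Rescaling time, the value at time 1 of the curve with parameter c is the flow at time c.
  let ev : C(unitInterval, E) →L[ℝ] E := ContinuousMap.evalCLM ℝ 1
  refine ⟨fun p => ev (A p), ι ⁻¹' e.target, hU, ?_, ev.contDiff.comp_contDiffOn hAs, ?_, ?_⟩
  · have := e.map_source hae
    rw [hef] at this
    simpa [flowEquation, ι] using this
  · intro p hp
    have hAd : HasFDerivAt A (fderiv ℝ A p) p :=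
      ((hAs.contDiffAt (hU.mem_nhds hp)).differentiableAt (by simp)).hasFDerivAt
    set B := fderiv ℝ A p (1, 0) with hB
    have hmem : ((p.1, p.2, A p) : ℝ × E × C(unitInterval, E)) ∈ e.source := by
      rw [← (key p hp).1]; exact e.map_target hp
    have hGd : HasFDerivAt (flowEquation hX) (fderiv ℝ (flowEquation hX) (p.1, p.2, A p))
      (p.1, p.2, A p) := ((contDiff_flowEquation hX).differentiable (by simp) _).hasFDerivAt
    have hcomp := hGd.comp p
      ((hasFDerivAt_fst (𝕜 := ℝ) (E := ℝ) (F := E)).prodMk (hasFDerivAt_snd.prodMk hAd))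
    have heq : (flowEquation hX ∘ fun q : ℝ × E => (q.1, q.2, A q)) =ᶠ[𝓝 p] ι := by
      filter_upwards [hU.mem_nhds hp] with q hq
      rw [Function.comp_apply, ← (key q hq).1, ← hef]
      exact e.right_inv hq
    have hιd : HasFDerivAt ι ((ContinuousLinearMap.fst ℝ ℝ E).prod
        ((ContinuousLinearMap.snd ℝ ℝ E).prod 0)) p :=
      hasFDerivAt_fst.prodMk (hasFDerivAt_snd.prodMk (hasFDerivAt_const _ _))
    have huniq := (hcomp.congr_of_eventuallyEq heq.symm).unique hιd
    have h10 := congrArg (fun L => L ((1 : ℝ), (0 : E))) huniq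
    have h10' : fderiv ℝ (flowEquation hX) (p.1, p.2, A p) (1, 0, B) = (1, 0, 0) := h10
    -- The expected derivative of the curve in c. It solves the same linear equation as `B`, whose
    -- solution is unique because the derivative of `flowEquation` is invertible.
    let β : C(unitInterval, E) := ⟨fun t => (t : ℝ) • X (A p t),
      continuous_subtype_val.smul (hX.continuous.comp (A p).continuous)⟩
    have hβ := smul_comp_eq_primitiveCLM hX (β := β) (key p hp).2 (fun t => rfl)
    have hβ' : fderiv ℝ (flowEquation hX) (p.1, p.2, A p) (1, 0, β) = (1, 0, 0) := by
      rw [fderiv_flowEquation_apply]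
      simp only [map_zero, sub_zero, one_smul]
      rw [add_comm, ← hβ, sub_self]
    obtain ⟨g, hg⟩ := hinv _ hmem
    have hBβ : ((1 : ℝ), (0 : E), B) = (1, 0, β) := by
      apply g.injective
      have := h10'.trans hβ'.symm
      rw [← hg] at this
      exact this
    have hB' : B = β := congrArg (fun q => q.2.2) hBβ
    have hev : HasFDerivAt (fun p => ev (A p)) (ev.comp (fderiv ℝ A p)) p :=
      ev.hasFDerivAt.comp p hAd
    rw [hev.fderiv]
    change ev B = _
    rw [hB']
    change ((1 : unitInterval) : ℝ) • X (A p 1) = X (A p 1)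
    simp
  · intro x hx
    have := (key (0, x) hx).2
    simp only [zero_smul, add_zero] at this
    change (A (0, x)) 1 = x
    rw [this]
    rfl

/-- Smooth local flow of a smooth vector field. -/
theorem exists_smooth_flow [FiniteDimensional ℝ E] {V : Set E} (hV : IsOpen V) {x₀ : E}
    (hx₀ : x₀ ∈ V) (hX : ContDiffOn ℝ ∞ X V) :
    ∃ (Φ : ℝ × E → E) (U : Set (ℝ × E)), IsOpen U ∧ (0, x₀) ∈ U ∧ ContDiffOn ℝ ∞ Φ U ∧
      (∀ p ∈ U, Φ p ∈ V ∧ fderiv ℝ Φ p (1, 0) = X (Φ p)) ∧ ∀ x, (0, x) ∈ U → Φ (0, x) = x := by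
  have := FiniteDimensional.complete ℝ E
  obtain ⟨Y, hY, hYX⟩ := exists_contDiff_eventuallyEq (hV.mem_nhds hx₀) hX
  obtain ⟨S, hS, hSo, hxS⟩ := mem_nhds_iff.1 (Filter.inter_mem hYX (hV.mem_nhds hx₀))
  obtain ⟨Φ, U, hU, h0, hΦ, hd, hi⟩ := exists_smooth_flow_of_contDiff hY x₀
  refine ⟨Φ, U ∩ Φ ⁻¹' S, hΦ.continuousOn.isOpen_inter_preimage hU hSo, ⟨h0, ?_⟩,
    hΦ.mono Set.inter_subset_left, fun p hp => ⟨(hS hp.2).2, ?_⟩, fun x hx => hi x hx.1⟩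
  · rw [Set.mem_preimage, hi x₀ h0]; exact hxS
  · rw [hd p hp.1]; exact (hS hp.2).1

end Flow

/-! ### Linear transport along flows; the composition of two flows. -/

section Transport

variable {E G : Type} [NormedAddCommGroup E] [NormedSpace ℝ E]
  [NormedAddCommGroup G] [NormedSpace ℝ G]

/-- Solutions of linear differential equations vanishing at one point vanish. -/
theorem eq_zero_of_linear_ode {A : ℝ → E →L[ℝ] E} {y : ℝ → E} {ε : ℝ}
    (hA : ContinuousOn A (Set.Ioo (-ε) ε))
    (hy : ∀ s ∈ Set.Ioo (-ε) ε, HasDerivAt y (A s (y s)) s) (h0 : y 0 = 0) :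
    ∀ s ∈ Set.Ioo (-ε) ε, y s = 0 := by
  intro s hs
  -- A uniform Lipschitz constant is available only on compact subintervals.
  obtain ⟨r, hsr, hrε⟩ := exists_between (abs_lt.2 hs)
  have hr : 0 < r := (abs_nonneg s).trans_lt hsr
  have hsub : Set.Icc (-r) r ⊆ Set.Ioo (-ε) ε := fun t ht =>
    ⟨by linarith [ht.1], by linarith [ht.2]⟩
  obtain ⟨C, hC⟩ := isCompact_Icc.exists_bound_of_continuousOn (hA.mono hsub)
  have hioo : Set.Ioo (-r) r ⊆ Set.Icc (-r) r := Set.Ioo_subset_Icc_self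
  have := ODE_solution_unique_of_mem_Ioo (v := fun t x => A t x) (s := fun _ => Set.univ)
    (K := C.toNNReal) (f := y) (g := fun _ => 0) (t₀ := 0) (a := -r) (b := r)
    (fun t ht => ((A t).lipschitz.weaken (by
      rw [← NNReal.coe_le_coe, coe_nnnorm]
      exact (hC t (hioo ht)).trans (Real.le_coe_toNNReal C))).lipschitzOnWith)
    ⟨by linarith, hr⟩ (fun t ht => ⟨hy t (hsub (hioo ht)), trivial⟩)
    (fun t _ => ⟨by simpa using hasDerivAt_const t (0 : E), trivial⟩) h0
  exact this (abs_lt.1 hsr)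

/-- The variational equation: derivatives of a family of integral curves of `X` satisfy the
linearized equation. -/
theorem fderiv_fderiv_of_integralCurves {H : G → E} {S : Set G} {V : Set E} {X : E → E}
    {e₁ : G} (hS : IsOpen S) (hV : IsOpen V) (hH : ContDiffOn ℝ ∞ H S) (hX : ContDiffOn ℝ ∞ X V)
    (hHV : ∀ p ∈ S, H p ∈ V ∧ fderiv ℝ H p e₁ = X (H p)) {p : G} (hp : p ∈ S) (e₂ : G) :
    fderiv ℝ (fderiv ℝ H) p e₁ e₂ = fderiv ℝ X (H p) (fderiv ℝ H p e₂) := by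
  have hHp := hH.contDiffAt (hS.mem_nhds hp)
  -- Symmetry of the second derivative turns the claim into the derivative, in direction e₂, of the
  -- equation of the integral curves.
  have hsymm : fderiv ℝ (fderiv ℝ H) p e₁ e₂ = fderiv ℝ (fderiv ℝ H) p e₂ e₁ :=
    (hHp.isSymmSndFDerivAt (by
      rw [minSmoothness_of_isRCLikeNormedField]; exact WithTop.coe_le_coe.2 le_top)).eq e₁ e₂
  have hHd : HasFDerivAt (fderiv ℝ H) (fderiv ℝ (fderiv ℝ H) p) p :=
    ((hHp.fderiv_right (m := ∞) (by simp)).differentiableAt (by simp)).hasFDerivAt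
  have h1 : HasFDerivAt (fun q => fderiv ℝ H q e₁) _ p := hHd.clm_apply (hasFDerivAt_const e₁ p)
  have hXd : HasFDerivAt X (fderiv ℝ X (H p)) (H p) :=
    ((hX.contDiffAt (hV.mem_nhds (hHV p hp).1)).differentiableAt (by simp)).hasFDerivAt
  have h2 : HasFDerivAt (fun q => X (H q)) _ p :=
    hXd.comp p (hHp.differentiableAt (by simp)).hasFDerivAt
  have heq : (fun q => fderiv ℝ H q e₁) =ᶠ[𝓝 p] fun q => X (H q) := by
    filter_upwards [hS.mem_nhds hp] with q hq using (hHV q hq).2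
  have := congrArg (fun L => L e₂) ((h2.congr_of_eventuallyEq heq).unique h1)
  rw [hsymm]
  simpa using this.symm

/-- The composition of the flows of two vector fields, the second one applied first. -/
theorem exists_two_flows [FiniteDimensional ℝ E] {V : Set E} (hV : IsOpen V) {a : E}
    (ha : a ∈ V) {X Y : E → E} (hX : ContDiffOn ℝ ∞ X V) (hY : ContDiffOn ℝ ∞ Y V) :
    ∃ (H : ℝ × ℝ × E → E) (ε : ℝ), 0 < ε ∧ ContDiffOn ℝ ∞ H (Metric.ball (0, 0, a) ε) ∧
      ∀ p ∈ Metric.ball ((0, 0, a) : ℝ × ℝ × E) ε,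
        (H p ∈ V ∧ fderiv ℝ H p (1, 0, 0) = X (H p)) ∧
        (p.1 = 0 → fderiv ℝ H p (0, 1, 0) = Y (H p)) ∧
        (p.1 = 0 → p.2.1 = 0 → H p = p.2.2 ∧ ∀ w, fderiv ℝ H p (0, 0, w) = w) := by
  obtain ⟨Φ, U, hU, h0U, hΦ, hΦX, hΦi⟩ := exists_smooth_flow hV ha hX
  obtain ⟨Ψ, U', hU', h0U', hΨ, hΨY, hΨi⟩ := exists_smooth_flow hV ha hY
  -- The composition is H(s, t, x) = Φ(s, Ψ(t, x)).
  let T : ℝ × ℝ × E → ℝ × E := fun p => (p.1, Ψ p.2)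
  let S : Set (ℝ × ℝ × E) := Prod.snd ⁻¹' U'
  have hT : ContDiffOn ℝ ∞ T S :=
    contDiff_fst.contDiffOn.prodMk (hΨ.comp contDiff_snd.contDiffOn fun _ h => h)
  have hS : IsOpen S := hU'.preimage continuous_snd
  have hopen : IsOpen ((S ∩ T ⁻¹' U) ∩ (fun p => ((0 : ℝ), T p |>.2)) ⁻¹' U ∩ S) := by
    have h1 : IsOpen (S ∩ T ⁻¹' U) := hT.continuousOn.isOpen_inter_preimage hS hU
    have h2 : IsOpen (S ∩ (fun p => ((0 : ℝ), (T p).2)) ⁻¹' U) :=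
      (continuousOn_const.prodMk (continuous_snd.comp_continuousOn hT.continuousOn)
        ).isOpen_inter_preimage hS hU
    convert! h1.inter h2 using 1
    ext p; simp only [Set.mem_inter_iff]; tauto
  have hmem : ((0, 0, a) : ℝ × ℝ × E) ∈
      (S ∩ T ⁻¹' U) ∩ (fun p => ((0 : ℝ), T p |>.2)) ⁻¹' U ∩ S := by
    have : T (0, 0, a) = (0, a) := Prod.ext rfl (hΨi a h0U')
    refine ⟨⟨⟨h0U', ?_⟩, ?_⟩, h0U'⟩
    · rw [Set.mem_preimage, this]; exact h0U
    · rw [Set.mem_preimage, this]; exact h0U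
  obtain ⟨ε, hε, hball⟩ := Metric.isOpen_iff.1 hopen _ hmem
  have hH : ContDiffOn ℝ ∞ (Φ ∘ T) (S ∩ T ⁻¹' U) :=
    hΦ.comp (hT.mono Set.inter_subset_left) fun _ h => h.2
  refine ⟨Φ ∘ T, ε, hε, hH.mono fun p hp => (hball hp).1.1, fun p hp => ?_⟩
  obtain ⟨⟨⟨hpS, hpU⟩, hpU0⟩, -⟩ := hball hp
  have hΨd : HasFDerivAt Ψ (fderiv ℝ Ψ p.2) p.2 :=
    ((hΨ.contDiffAt (hU'.mem_nhds hpS)).differentiableAt (by simp)).hasFDerivAt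
  have hTd : HasFDerivAt T _ p := hasFDerivAt_fst.prodMk (hΨd.comp p hasFDerivAt_snd)
  have hΦd : HasFDerivAt Φ (fderiv ℝ Φ (T p)) (T p) :=
    ((hΦ.contDiffAt (hU.mem_nhds hpU)).differentiableAt (by simp)).hasFDerivAt
  have hd : ∀ v, fderiv ℝ (Φ ∘ T) p v = fderiv ℝ Φ (T p) (v.1, fderiv ℝ Ψ p.2 v.2) := by
    intro v
    rw [(hΦd.comp p hTd).fderiv]
    rfl
  have hid : p.1 = 0 → Φ (T p) = Ψ p.2 ∧ ∀ w, fderiv ℝ Φ (T p) (0, w) = w := by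
    intro hp0
    have hTp : T p = (0, Ψ p.2) := Prod.ext hp0 rfl
    have hpU0' : (0, Ψ p.2) ∈ U := hpU0
    refine ⟨by rw [hTp]; exact hΦi _ hpU0', fun w => ?_⟩
    rw [hTp] at hΦd ⊢
    have h1 : HasFDerivAt (fun y : E => Φ (0, y)) _ (Ψ p.2) :=
      hΦd.comp (Ψ p.2) ((hasFDerivAt_const (0 : ℝ) _).prodMk (hasFDerivAt_id _))
    have h2 : (fun y : E => Φ (0, y)) =ᶠ[𝓝 (Ψ p.2)] id := by
      have : (fun y : E => ((0 : ℝ), y)) ⁻¹' U ∈ 𝓝 (Ψ p.2) :=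
        (hU.preimage (by fun_prop)).mem_nhds hpU0'
      filter_upwards [this] with y hy using hΦi y hy
    have := congrArg (fun L => L w) (((hasFDerivAt_id _).congr_of_eventuallyEq h2).unique h1)
    simpa using this.symm
  refine ⟨⟨(hΦX _ hpU).1, ?_⟩, ?_, ?_⟩
  · rw [hd, show ((0, 0) : ℝ × E) = 0 from rfl, map_zero]
    exact (hΦX _ hpU).2
  · intro hp0
    rw [hd, (hid hp0).2, (hΨY _ hpS).2, Function.comp_apply, (hid hp0).1]
  · intro hp0 hp1
    have hp2 : p.2 = (0, p.2.2) := Prod.ext hp1 rfl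
    have hmem : ((0 : ℝ), p.2.2) ∈ U' := by rw [← hp2]; exact hpS
    refine ⟨by rw [Function.comp_apply, (hid hp0).1, hp2]; exact hΨi _ hmem, fun w => ?_⟩
    rw [hd, (hid hp0).2]
    rw [hp2] at hΨd ⊢
    have h1 : HasFDerivAt (fun y : E => Ψ (0, y)) _ p.2.2 :=
      hΨd.comp p.2.2 ((hasFDerivAt_const (0 : ℝ) _).prodMk (hasFDerivAt_id _))
    have h2 : (fun y : E => Ψ (0, y)) =ᶠ[𝓝 p.2.2] id := by
      have : (fun y : E => ((0 : ℝ), y)) ⁻¹' U' ∈ 𝓝 p.2.2 :=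
        (hU'.preimage (by fun_prop)).mem_nhds hmem
      filter_upwards [this] with y hy using hΨi y hy
    have := congrArg (fun L => L w) (((hasFDerivAt_id _).congr_of_eventuallyEq h2).unique h1)
    simpa using this.symm

/-- Balls for the sup metric are products, so an equation in s with t and x fixed can be followed
over the full interval without leaving the ball. -/
theorem mem_ball_triple {E : Type} [NormedAddCommGroup E] {a : E} {ε : ℝ} {s t : ℝ} {x : E} :
    (s, t, x) ∈ Metric.ball ((0, 0, a) : ℝ × ℝ × E) ε ↔
      s ∈ Set.Ioo (-ε) ε ∧ |t| < ε ∧ dist x a < ε := by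
  simp only [Metric.mem_ball, Prod.dist_eq, max_lt_iff, Real.dist_eq, sub_zero, Set.mem_Ioo,
    abs_lt]

theorem hasDerivAt_triple (s t : ℝ) (x : E) :
    HasDerivAt (fun s : ℝ => (s, t, x)) ((1, 0, 0) : ℝ × ℝ × E) s :=
  (hasDerivAt_id s).prodMk (hasDerivAt_const s (t, x))

theorem hasDerivAt_fderiv_apply {H : ℝ × ℝ × E → G} {s t : ℝ} {x : E}
    (hH : ContDiffAt ℝ ∞ H (s, t, x)) (w : ℝ × ℝ × E) :
    HasDerivAt (fun s : ℝ => fderiv ℝ H (s, t, x) w)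
      (fderiv ℝ (fderiv ℝ H) (s, t, x) (1, 0, 0) w) s := by
  have h0 : HasFDerivAt (fderiv ℝ H) (fderiv ℝ (fderiv ℝ H) (s, t, x)) (s, t, x) :=
    ((hH.fderiv_right (m := ∞) (by simp)).differentiableAt (by simp)).hasFDerivAt
  have h1 : HasDerivAt (fun s : ℝ => fderiv ℝ H (s, t, x))
      (fderiv ℝ (fderiv ℝ H) (s, t, x) (1, 0, 0)) s :=
    h0.comp_hasDerivAt s (hasDerivAt_triple s t x)
  exact (ContinuousLinearMap.apply ℝ G w).hasFDerivAt.comp_hasDerivAt s h1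

/-- If `X` and `Y` commute then `∂H/∂t = Y ∘ H` for the composition `H` of their flows as soon as
this holds at `s = 0`. -/
theorem fderiv_eq_of_lieBracket_eq_zero {V : Set E} (hV : IsOpen V) {X Y : E → E}
    (hX : ContDiffOn ℝ ∞ X V) (hY : ContDiffOn ℝ ∞ Y V)
    (hXY : ∀ x ∈ V, VectorField.lieBracket ℝ X Y x = 0) {H : ℝ × ℝ × E → E} {a : E} {ε : ℝ}
    (hH : ContDiffOn ℝ ∞ H (Metric.ball (0, 0, a) ε))
    (hs : ∀ p ∈ Metric.ball ((0, 0, a) : ℝ × ℝ × E) ε,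
      H p ∈ V ∧ fderiv ℝ H p (1, 0, 0) = X (H p))
    (ht : ∀ p ∈ Metric.ball ((0, 0, a) : ℝ × ℝ × E) ε,
      p.1 = 0 → fderiv ℝ H p (0, 1, 0) = Y (H p)) :
    ∀ p ∈ Metric.ball ((0, 0, a) : ℝ × ℝ × E) ε, fderiv ℝ H p (0, 1, 0) = Y (H p) := by
  rintro ⟨s, t, x⟩ hp
  obtain ⟨hsε, hrest⟩ := mem_ball_triple.1 hp
  have hmem : ∀ s ∈ Set.Ioo (-ε) ε, (s, t, x) ∈ Metric.ball ((0, 0, a) : ℝ × ℝ × E) ε :=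
    fun s hs => mem_ball_triple.2 ⟨hs, hrest⟩
  have hHat : ∀ s ∈ Set.Ioo (-ε) ε, ContDiffAt ℝ ∞ H (s, t, x) := fun s hs =>
    hH.contDiffAt (Metric.isOpen_ball.mem_nhds (hmem s hs))
  have hε : 0 < ε := by linarith [hsε.1.trans hsε.2]
  rw [← sub_eq_zero]
  -- Both ∂H/∂t and Y ∘ H satisfy y' = DX(H) y in s: the first by the variational equation, the
  -- second because [X, Y] = 0 means DY·X = DX·Y.
  refine eq_zero_of_linear_ode (A := fun s => fderiv ℝ X (H (s, t, x)))
    (y := fun s => fderiv ℝ H (s, t, x) (0, 1, 0) - Y (H (s, t, x))) ?_ ?_ ?_ s hsε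
  · have hHc : ContinuousOn (fun s => H (s, t, x)) (Set.Ioo (-ε) ε) :=
      hH.continuousOn.comp (by fun_prop) hmem
    exact (hX.continuousOn_fderiv_of_isOpen hV (by simp)).comp hHc fun s hs' => (hs _ (hmem s hs')).1
  · intro r hr
    have hHV := hs _ (hmem r hr)
    have hp := hasDerivAt_triple r t x
    have h1 := hasDerivAt_fderiv_apply (hHat r hr) (0, 1, 0)
    have hYd : HasFDerivAt Y (fderiv ℝ Y (H (r, t, x))) (H (r, t, x)) :=
      ((hY.contDiffAt (hV.mem_nhds hHV.1)).differentiableAt (by simp)).hasFDerivAt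
    have h2 := hYd.comp_hasDerivAt r
      (((hHat r hr).differentiableAt (by simp)).hasFDerivAt.comp_hasDerivAt r hp)
    refine (h1.sub h2).congr_deriv ?_
    have hb := hXY _ hHV.1
    rw [VectorField.lieBracket_eq, sub_eq_zero] at hb
    rw [fderiv_fderiv_of_integralCurves Metric.isOpen_ball hV hH hX hs (hmem r hr), hHV.2,
      map_sub, hb]
  · rw [sub_eq_zero]
    exact ht _ (hmem 0 ⟨by linarith, hε⟩) rfl

end Transport

/-! ### Functional dependence. -/

section Dependence

variable {E G : Type} [NormedAddCommGroup E] [NormedSpace ℝ E] [FiniteDimensional ℝ E]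
  [NormedAddCommGroup G] [NormedSpace ℝ G] [FiniteDimensional ℝ G]

theorem isInvertible_of_bijective {F : Type} [NormedAddCommGroup F] [NormedSpace ℝ F]
    {L : E →L[ℝ] F} (hL : Function.Bijective L) : L.IsInvertible :=
  ⟨(LinearEquiv.ofBijective (L : E →ₗ[ℝ] F) hL).toContinuousLinearEquiv, by ext; rfl⟩

/-- A function whose differential vanishes on the kernel of the differential of a submersion `F`
is locally a function of `F`. -/
theorem exists_eq_comp_of_ker_fderiv_le {F : E → G} {g : E → ℝ} {V : Set E} (hV : IsOpen V)
    {a : E} (ha : a ∈ V) (hF : ContDiffOn ℝ ∞ F V) (hg : ContDiffOn ℝ ∞ g V)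
    (hsurj : Function.Surjective (fderiv ℝ F a))
    (hker : ∀ x ∈ V, ∀ v, fderiv ℝ F x v = 0 → fderiv ℝ g x v = 0) :
    ∃ φ : G → ℝ, ContDiff ℝ ∞ φ ∧ ∀ᶠ x in 𝓝 a, g x = φ (F x) := by
  have : CompleteSpace E := FiniteDimensional.complete ℝ E
  let N := LinearMap.ker (fderiv ℝ F a : E →ₗ[ℝ] G)
  obtain ⟨P₀, hP₀⟩ := N.exists_isCompl.imp fun q hq => hq
  -- A projection onto ker dF(a), so that (F, P) is a local coordinate system at a.
  let P : E →L[ℝ] N := LinearMap.toContinuousLinearMap (N.projectionOnto P₀ hP₀)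
  have hPN : ∀ v : N, P v = v := fun v => Submodule.projectionOnto_apply_left hP₀ v
  have hf : ContDiffOn ℝ ∞ (fun x => (F x, P x)) V := hF.prodMk P.contDiff.contDiffOn
  have hfd : ∀ x ∈ V, HasFDerivAt (fun x => (F x, P x)) ((fderiv ℝ F x).prod P) x := fun x hx =>
    ((hF.contDiffAt (hV.mem_nhds hx)).differentiableAt (by simp)).hasFDerivAt.prodMk P.hasFDerivAt
  have hinv : (fderiv ℝ (fun x => (F x, P x)) a).IsInvertible := by
    rw [(hfd a ha).fderiv]
    refine isInvertible_of_bijective ⟨?_, ?_⟩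
    · rw [injective_iff_map_eq_zero]
      intro v hv
      have h1 : fderiv ℝ F a v = 0 := congrArg Prod.fst hv
      have h2 : P v = 0 := congrArg Prod.snd hv
      have h3 := hPN ⟨v, h1⟩
      rw [h2] at h3
      exact (congrArg Subtype.val h3).symm
    · rintro ⟨y, n⟩
      obtain ⟨v, rfl⟩ := hsurj y
      refine ⟨v + (n - P v : N), ?_⟩
      have h1 : fderiv ℝ F a ((n - P v : N) : E) = 0 := (n - P v : N).2
      refine Prod.ext ?_ ?_
      · change fderiv ℝ F a (v + (n - P v : N)) = _
        rw [map_add, h1, add_zero]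
      · change P (v + (n - P v : N)) = n
        rw [map_add, hPN]
        abel
  obtain ⟨e, hae, heV, hef, heinv, hesymm⟩ := exists_smooth_local_inverse hV hf ha hinv
  have hb : (F a, P a) ∈ e.target := by
    have := e.map_source hae
    rwa [hef] at this
  obtain ⟨ε, hε, hball⟩ := Metric.isOpen_iff.1 e.open_target _ hb
  let h : G × N → ℝ := fun q => g (e.symm q)
  have hh : ContDiffOn ℝ ∞ h e.target := hg.comp hesymm fun q hq => heV (e.map_target hq)
  -- In the coordinates (y, n), moving n alone moves within ker dF, so g does not depend on n on a
  -- product of balls.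
  have hconst : ∀ y ∈ Metric.ball (F a) ε, ∀ n ∈ Metric.ball (P a) ε, h (y, n) = h (y, P a) := by
    intro y hy n hn
    have hmem : ∀ n ∈ Metric.ball (P a) ε, (y, n) ∈ e.target := fun n hn =>
      hball (by rw [Metric.mem_ball, Prod.dist_eq]; exact max_lt hy hn)
    have hd : ∀ n ∈ Metric.ball (P a) ε, HasFDerivAt (fun n => h (y, n)) (0 : N →L[ℝ] ℝ) n := by
      intro n hn
      have hmt := e.map_target (hmem n hn)
      have hsd : HasFDerivAt e.symm (fderiv ℝ e.symm (y, n)) (y, n) :=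
        ((hesymm.contDiffAt (e.open_target.mem_nhds (hmem n hn))).differentiableAt
          (by simp)).hasFDerivAt
      have hgd : HasFDerivAt g (fderiv ℝ g (e.symm (y, n))) (e.symm (y, n)) :=
        ((hg.contDiffAt (hV.mem_nhds (heV hmt))).differentiableAt (by simp)).hasFDerivAt
      have hcomp := hgd.comp n (hsd.comp n ((hasFDerivAt_const y n).prodMk (hasFDerivAt_id n)))
      refine hcomp.congr_fderiv ?_
      ext κ
      refine hker _ (heV hmt) _ ?_
      have hid := (hfd _ (heV hmt)).comp (y, n) hsd
      have heq : (fun x => (F x, P x)) ∘ e.symm =ᶠ[𝓝 (y, n)] id := by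
        filter_upwards [e.open_target.mem_nhds (hmem n hn)] with q hq
        have hq' := e.right_inv hq
        rw [hef] at hq'
        exact hq'
      have := congrArg (fun L => (L ((0 : G), κ)).1)
        (((hasFDerivAt_id (𝕜 := ℝ) (y, n)).congr_of_eventuallyEq heq).unique hid)
      exact this.symm
    exact (convex_ball (P a) ε).is_const_of_fderivWithin_eq_zero (𝕜 := ℝ)
      (f := fun n => h (y, n))
      (fun n hn => (hd n hn).differentiableAt.differentiableWithinAt)
      (fun n hn => by
        rw [fderivWithin_of_isOpen Metric.isOpen_ball hn]; exact (hd n hn).fderiv)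
      hn (Metric.mem_ball_self hε)
  have hφ₀ : ContDiffOn ℝ ∞ (fun y => h (y, P a)) (Metric.ball (F a) ε) :=
    hh.comp (contDiff_id.prodMk contDiff_const).contDiffOn fun y hy =>
      hball (by rw [Metric.mem_ball, Prod.dist_eq]; exact max_lt hy (by simpa using hε))
  obtain ⟨φ, hφ, hφφ₀⟩ := exists_contDiff_eventuallyEq (Metric.ball_mem_nhds _ hε) hφ₀
  refine ⟨φ, hφ, ?_⟩
  have hFc : ContinuousAt F a := (hF.contDiffAt (hV.mem_nhds ha)).continuousAt
  filter_upwards [hFc.eventually hφφ₀, hFc.eventually (Metric.ball_mem_nhds _ hε),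
    P.continuous.continuousAt.eventually (Metric.ball_mem_nhds _ hε),
    e.open_source.mem_nhds hae] with x h1 h2 h3 h4
  rw [h1, ← hconst _ h2 _ h3]
  have := e.left_inv h4
  rw [hef] at this
  exact (congrArg g this).symm

end Dependence

/-! ### Straightening two commuting fields. -/

/-- Two commuting vector fields in normal form have three independent first integrals. -/
theorem exists_first_integrals_of_commuting {V : Set J1} (hV : IsOpen V) {a : J1} (ha : a ∈ V)
    {X Y : J1 → J1} (hX : ContDiffOn ℝ ∞ X V) (hY : ContDiffOn ℝ ∞ Y V) {i j : Fin 5}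
    (hij : i ≠ j) (hXi : X a i = 1) (hXj : X a j = 0) (hYi : Y a i = 0) (hYj : Y a j = 1)
    (hXY : ∀ x ∈ V, VectorField.lieBracket ℝ X Y x = 0) :
    ∃ (O : Set J1) (F : J1 → Fin 3 → ℝ), IsOpen O ∧ a ∈ O ∧ O ⊆ V ∧ ContDiffOn ℝ ∞ F O ∧
      ∀ θ ∈ O, Function.Surjective (fderiv ℝ F θ) ∧ fderiv ℝ F θ (X θ) = 0 ∧
        fderiv ℝ F θ (Y θ) = 0 := by
  obtain ⟨H, ε, hε, hH, hHp⟩ := exists_two_flows hV ha hX hY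
  have hHY := fderiv_eq_of_lieBracket_eq_zero hV hX hY hXY hH (fun p hp => (hHp p hp).1)
    (fun p hp => (hHp p hp).2.1)
  let pi : J1 →L[ℝ] ℝ := ContinuousLinearMap.proj (R := ℝ) (φ := fun _ : Fin 5 => ℝ) i
  let pj : J1 →L[ℝ] ℝ := ContinuousLinearMap.proj (R := ℝ) (φ := fun _ : Fin 5 => ℝ) j
  let Q : J1 →L[ℝ] J1 := ContinuousLinearMap.id ℝ J1 - pi.smulRight (Pi.single i 1)
    - pj.smulRight (Pi.single j 1)
  let L : J1 →L[ℝ] ℝ × ℝ × J1 := pi.prod (pj.prod Q)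
  have hL : ∀ v, L v = (v i, v j, v - v i • Pi.single i 1 - v j • Pi.single j 1) := fun v => rfl
  -- The i-th and j-th coordinates of u - a become flow times, and the other coordinates locate a
  -- starting point in the slice through a.
  let l : J1 → ℝ × ℝ × J1 := fun u => L (u - a) + (0, 0, a)
  have hl : ContDiff ℝ ∞ l := (L.contDiff.comp (contDiff_id.sub contDiff_const)).add contDiff_const
  have hld : ∀ u, HasFDerivAt l L u := fun u => by
    have h := (L.hasFDerivAt.comp u ((hasFDerivAt_id u).sub_const a)).add_const (0, 0, a)
    rw [ContinuousLinearMap.comp_id] at h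
    exact h
  let S : Set J1 := l ⁻¹' Metric.ball (0, 0, a) ε
  have hS : IsOpen S := Metric.isOpen_ball.preimage hl.continuous
  have hla : l a = (0, 0, a) := by simp [l]
  have haS : a ∈ S := by
    rw [Set.mem_preimage, hla]; exact Metric.mem_ball_self hε
  have hΨ : ContDiffOn ℝ ∞ (H ∘ l) S := hH.comp hl.contDiffOn fun _ h => h
  have hΨd : ∀ u ∈ S, HasFDerivAt (H ∘ l) ((fderiv ℝ H (l u)).comp L) u := fun u hu =>
    ((hH.contDiffAt (Metric.isOpen_ball.mem_nhds hu)).differentiableAt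
      (by simp)).hasFDerivAt.comp u (hld u)
  have hLi : L (Pi.single i 1) = (1, 0, 0) := by
    rw [hL]; simp [hij.symm]
  have hLj : L (Pi.single j 1) = (0, 1, 0) := by
    rw [hL]; simp [hij]
  have hHa := (hHp (0, 0, a) (Metric.mem_ball_self hε)).2.2 rfl rfl
  have hΨX : ∀ u ∈ S, fderiv ℝ (H ∘ l) u (Pi.single i 1) = X ((H ∘ l) u) := fun u hu => by
    rw [(hΨd u hu).fderiv, ContinuousLinearMap.comp_apply, hLi]; exact (hHp _ hu).1.2
  have hΨY : ∀ u ∈ S, fderiv ℝ (H ∘ l) u (Pi.single j 1) = Y ((H ∘ l) u) := fun u hu => by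
    rw [(hΨd u hu).fderiv, ContinuousLinearMap.comp_apply, hLj]; exact hHY _ hu
  have hΨa : (H ∘ l) a = a := by rw [Function.comp_apply, hla]; exact hHa.1
  -- The derivative at a sends v to v_i X(a) + v_j Y(a) plus v with its i-th and j-th components
  -- removed. By the normal form, the i-th and j-th components of the image are v_i and v_j, whence
  -- injectivity.
  have hinv : (fderiv ℝ (H ∘ l) a).IsInvertible := by
    have hinj : Function.Injective (fderiv ℝ (H ∘ l) a) := by
      rw [injective_iff_map_eq_zero]
      intro v hv
      have hX' : fderiv ℝ H (0, 0, a) (1, 0, 0) = X a := by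
        rw [(hHp _ (Metric.mem_ball_self hε)).1.2, hHa.1]
      have hY' : fderiv ℝ H (0, 0, a) (0, 1, 0) = Y a := by
        rw [hHY _ (Metric.mem_ball_self hε), hHa.1]
      rw [(hΨd a haS).fderiv, ContinuousLinearMap.comp_apply, hla] at hv
      have hdec : L v = v i • ((1, 0, 0) : ℝ × ℝ × J1) + v j • ((0, 1, 0) : ℝ × ℝ × J1) +
          (0, 0, v - v i • Pi.single i 1 - v j • Pi.single j 1) := by
        rw [hL]; simp
      rw [hdec, map_add, map_add, map_smul, map_smul, hX', hY', hHa.2] at hv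
      have hvi := congrFun hv i
      have hvj := congrFun hv j
      simp [hXi, hYi, hij] at hvi
      simp [hXj, hYj, hij.symm] at hvj
      simpa [hvi, hvj] using hv
    exact isInvertible_of_bijective
      ⟨hinj, (LinearMap.injective_iff_surjective (f := (fderiv ℝ (H ∘ l) a : J1 →ₗ[ℝ] J1))).1 hinj⟩
  obtain ⟨e, hae, heS, hef, -, hesymm⟩ := exists_smooth_local_inverse hS hΨ haS hinv
  have hcard : (({i, j} : Finset (Fin 5))ᶜ).card = 3 := by
    rw [Finset.card_compl, Finset.card_pair hij]; rfl
  -- In the straightened chart X and Y are the i-th and j-th coordinate fields, so the three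
  -- remaining coordinates are first integrals.
  let c : Fin 3 ↪o Fin 5 := (({i, j} : Finset (Fin 5))ᶜ).orderEmbOfFin hcard
  have hc : ∀ k, c k ≠ i ∧ c k ≠ j := fun k => by
    have := Finset.orderEmbOfFin_mem _ hcard k
    rw [Finset.mem_compl] at this
    simpa only [Finset.mem_insert, Finset.mem_singleton, not_or] using this
  let C : J1 →L[ℝ] (Fin 3 → ℝ) := ContinuousLinearMap.pi fun k =>
    ContinuousLinearMap.proj (R := ℝ) (φ := fun _ : Fin 5 => ℝ) (c k)
  have hCsurj : Function.Surjective C := fun y =>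
    ⟨fun k => Function.extend c y 0 k, funext fun k => c.injective.extend_apply y 0 k⟩
  have hCi : C (Pi.single i 1) = 0 := funext fun k => Pi.single_eq_of_ne (hc k).1 _
  have hCj : C (Pi.single j 1) = 0 := funext fun k => Pi.single_eq_of_ne (hc k).2 _
  refine ⟨e.target, C ∘ e.symm, e.open_target, ?_, ?_, C.contDiff.comp_contDiffOn hesymm, ?_⟩
  · have := e.map_source hae
    rwa [hef, hΨa] at this
  · intro θ hθ
    have h1 := e.right_inv hθ
    rw [hef] at h1
    rw [← h1]
    exact (hHp _ (heS (e.map_target hθ))).1.1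
  · intro θ hθ
    have hsS := heS (e.map_target hθ)
    have h1 := e.right_inv hθ
    rw [hef] at h1
    have hsd : HasFDerivAt e.symm (fderiv ℝ e.symm θ) θ :=
      ((hesymm.contDiffAt (e.open_target.mem_nhds hθ)).differentiableAt (by simp)).hasFDerivAt
    have hsd' := hsd
    rw [← h1] at hsd'
    have heq : e.symm ∘ (H ∘ l) =ᶠ[𝓝 (e.symm θ)] id := by
      filter_upwards [e.open_source.mem_nhds (e.map_target hθ)] with u hu
      have := e.left_inv hu
      rw [hef] at this
      exact this
    have hid := ((hasFDerivAt_id (𝕜 := ℝ) (e.symm θ)).congr_of_eventuallyEq heq).unique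
      (hsd'.comp _ (hΨd _ hsS).differentiableAt.hasFDerivAt)
    rw [h1] at hid
    have hid' : ∀ v, fderiv ℝ e.symm θ (fderiv ℝ (H ∘ l) (e.symm θ) v) = v := fun v =>
      (congrArg (fun L => L v) hid).symm
    have hFd := C.hasFDerivAt.comp θ hsd
    rw [hFd.fderiv]
    refine ⟨fun y => ?_, ?_, ?_⟩
    · obtain ⟨v, rfl⟩ := hCsurj y
      exact ⟨fderiv ℝ (H ∘ l) (e.symm θ) v, congrArg C (hid' v)⟩
    · have := hid' (Pi.single i 1)
      rw [hΨX _ hsS, h1] at this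
      rw [ContinuousLinearMap.comp_apply, this, hCi]
    · have := hid' (Pi.single j 1)
      rw [hΨY _ hsS, h1] at this
      rw [ContinuousLinearMap.comp_apply, this, hCj]

/-! ### Symplectic linear algebra on the contact spaces. -/

section ContactAlgebra

theorem contactForm_apply (θ v : J1) : contactForm θ v = v 2 - θ 3 * v 0 - θ 4 * v 1 := rfl

theorem mem_contactDistribution {θ v : J1} :
    v ∈ contactDistribution θ ↔ v 2 = θ 3 * v 0 + θ 4 * v 1 := by
  change contactForm θ v = 0 ↔ _
  rw [contactForm_apply]
  constructor <;> intro h <;> linarith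

/-- The vector of the contact space at `θ` with given coordinates `dx, dy, dp, dq`. -/
def contactVector (θ : J1) (a b c d : ℝ) : J1 := ![a, b, θ 3 * a + θ 4 * b, c, d]

theorem contactVector_mem (θ : J1) (a b c d : ℝ) :
    contactVector θ a b c d ∈ contactDistribution θ :=
  mem_contactDistribution.2 rfl

theorem eq_contactVector {θ v : J1} (hv : v ∈ contactDistribution θ) :
    v = contactVector θ (v 0) (v 1) (v 3) (v 4) := by
  have := mem_contactDistribution.1 hv
  ext k
  fin_cases k <;> simp [contactVector, this]

theorem contactVector_combination (θ : J1) (a b c d : ℝ) :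
    contactVector θ a b c d = a • contactVector θ 1 0 0 0 + b • contactVector θ 0 1 0 0
      + c • contactVector θ 0 0 1 0 + d • contactVector θ 0 0 0 1 := by
  ext k
  fin_cases k <;> simp [contactVector]
  ring

theorem contDiffOn_contactVector {W : Set J1} {a b c d : J1 → ℝ} (ha : ContDiffOn ℝ ∞ a W)
    (hb : ContDiffOn ℝ ∞ b W) (hc : ContDiffOn ℝ ∞ c W) (hd : ContDiffOn ℝ ∞ d W) :
    ContDiffOn ℝ ∞ (fun θ => contactVector θ (a θ) (b θ) (c θ) (d θ)) W := by
  have h3 : ContDiffOn ℝ ∞ (fun θ : J1 => θ 3) W := (contDiff_apply ℝ ℝ (3 : Fin 5)).contDiffOn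
  have h4 : ContDiffOn ℝ ∞ (fun θ : J1 => θ 4) W := (contDiff_apply ℝ ℝ (4 : Fin 5)).contDiffOn
  refine contDiffOn_pi.2 fun k => ?_
  fin_cases k
  · exact ha
  · exact hb
  · exact (h3.mul ha).add (h4.mul hb)
  · exact hc
  · exact hd

/-- `dU` as a bilinear form. -/
noncomputable def dContactBilin : LinearMap.BilinForm ℝ J1 :=
  LinearMap.mk₂ ℝ dContactForm
    (fun _ _ _ => by simp only [dContactForm, Pi.add_apply]; ring)
    (fun _ _ _ => by simp only [dContactForm, Pi.smul_apply, smul_eq_mul]; ring)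
    (fun _ _ _ => by simp only [dContactForm, Pi.add_apply]; ring)
    (fun _ _ _ => by simp only [dContactForm, Pi.smul_apply, smul_eq_mul]; ring)

theorem dContactForm_swap (v w : J1) : dContactForm v w = -dContactForm w v := by
  simp only [dContactForm]; ring

/-- The dimensions of a subspace of a contact space and of its skew-orthogonal. -/
theorem finrank_add_finrank_orthogonal_of_le_contact {θ : J1} {N : Submodule ℝ J1}
    (hN : N ≤ contactDistribution θ) :
    Module.finrank ℝ N + Module.finrank ℝ (dContactBilin.orthogonal N) = 5 := by
  have h := LinearMap.BilinForm.finrank_add_finrank_orthogonal' (B := dContactBilin) N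
  -- The kernel of dU on ℝ⁵ is the line of ∂_z, which is transverse to the contact space.
  have hbot : N ⊓ dContactBilin.ker = ⊥ := by
    rw [eq_bot_iff]
    rintro v ⟨hvN, hvk⟩
    have hk : ∀ w, dContactForm v w = 0 := fun w => congrArg (fun L => L w) hvk
    have h0 := hk (Pi.single 3 1)
    have h1 := hk (Pi.single 4 1)
    have h3 := hk (Pi.single 0 1)
    have h4 := hk (Pi.single 1 1)
    simp [dContactForm] at h0 h1 h3 h4
    have h2 := mem_contactDistribution.1 (hN hvN)
    rw [h0, h1] at h2
    simp only [Submodule.mem_bot]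
    ext k
    fin_cases k <;> simp [h0, h1, h3, h4, h2]
  rw [hbot, finrank_bot, Module.finrank_fin_fun] at h
  exact h

theorem single_two_notMem_contact (θ : J1) : Pi.single 2 1 ∉ contactDistribution θ := by
  rw [mem_contactDistribution]
  simp

theorem dContactForm_single_two (v : J1) : dContactForm v (Pi.single 2 1) = 0 := by
  simp [dContactForm]

/-- Orthogonals are taken in ℝ⁵ and always contain ∂_z. Adding this line, which is transverse to the
contact space, makes N comparable with its orthogonal. -/
theorem finrank_sup_span_single_two {θ : J1} {N : Submodule ℝ J1}
    (hN : N ≤ contactDistribution θ) :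
    Module.finrank ℝ (N ⊔ Submodule.span ℝ {(Pi.single 2 1 : J1)} : Submodule ℝ J1) =
      Module.finrank ℝ N + 1 := by
  have hne : (Pi.single 2 1 : J1) ≠ 0 := fun h => by simpa using congrFun h 2
  have h := Submodule.finrank_sup_add_finrank_inf_eq N (Submodule.span ℝ {(Pi.single 2 1 : J1)})
  have hbot : N ⊓ Submodule.span ℝ {(Pi.single 2 1 : J1)} = ⊥ := by
    rw [eq_bot_iff]
    rintro v ⟨hvN, hvs⟩
    obtain ⟨c, rfl⟩ := Submodule.mem_span_singleton.1 hvs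
    have := mem_contactDistribution.1 (hN hvN)
    simp at this
    simp [this]
  rw [hbot, finrank_bot, finrank_span_singleton hne] at h
  exact h

theorem sup_span_single_two_le_orthogonal {N : Submodule ℝ J1}
    (hiso : ∀ v ∈ N, ∀ w ∈ N, dContactForm v w = 0) :
    N ⊔ Submodule.span ℝ {(Pi.single 2 1 : J1)} ≤ dContactBilin.orthogonal N := by
  refine sup_le (fun v hv n hn => hiso n hn v hv) ?_
  rw [Submodule.span_singleton_le_iff_mem]
  exact fun n _ => dContactForm_single_two n

/-- Isotropic subspaces of a contact space have dimension at most two. -/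
theorem finrank_le_two_of_isotropic {θ : J1} {N : Submodule ℝ J1}
    (hN : N ≤ contactDistribution θ) (hiso : ∀ v ∈ N, ∀ w ∈ N, dContactForm v w = 0) :
    Module.finrank ℝ N ≤ 2 := by
  have h1 := finrank_add_finrank_orthogonal_of_le_contact hN
  have h2 := Submodule.finrank_mono (sup_span_single_two_le_orthogonal hiso)
  rw [finrank_sup_span_single_two hN] at h2
  omega

/-- Two-dimensional isotropic subspaces of a contact space are maximal. -/
theorem mem_of_isotropic {θ : J1} {N : Submodule ℝ J1}
    (hN : N ≤ contactDistribution θ) (hiso : ∀ v ∈ N, ∀ w ∈ N, dContactForm v w = 0)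
    (hdim : Module.finrank ℝ N = 2) {v : J1} (hv : v ∈ contactDistribution θ)
    (hvN : ∀ w ∈ N, dContactForm v w = 0) : v ∈ N := by
  have h1 := finrank_add_finrank_orthogonal_of_le_contact hN
  -- Both spaces have dimension 3.
  have heq := Submodule.eq_of_le_of_finrank_eq (sup_span_single_two_le_orthogonal hiso)
    (by rw [finrank_sup_span_single_two hN]; omega)
  have hmem : v ∈ dContactBilin.orthogonal N := fun n hn => by
    change dContactForm n v = 0
    rw [dContactForm_swap, hvN n hn, neg_zero]
  rw [← heq, Submodule.mem_sup] at hmem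
  obtain ⟨n, hn, z, hz, rfl⟩ := hmem
  obtain ⟨c, rfl⟩ := Submodule.mem_span_singleton.1 hz
  have h2 := mem_contactDistribution.1 hv
  have h3 := mem_contactDistribution.1 (hN hn)
  simp at h2 h3
  have hc : c = 0 := by linarith
  simpa [hc] using hn

end ContactAlgebra

/-! ### Two-forms as bilinear forms. -/

section TwoForms

/-- An alternating form of degree two as a bilinear form. -/
noncomputable def alternatingBilin (A : J1 [⋀^Fin 2]→L[ℝ] ℝ) : LinearMap.BilinForm ℝ J1 :=
  have hswap : ∀ v w : J1, A ![v, w] = -A ![w, v] := fun v w => by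
    have h := A.toAlternatingMap.map_swap (v := ![w, v]) (i := 0) (j := 1) (by simp)
    have h' : (![w, v] ∘ Equiv.swap (0 : Fin 2) 1) = ![v, w] := by
      ext k; fin_cases k <;> simp
    rw [h'] at h
    exact h
  LinearMap.mk₂ ℝ (fun v w => A ![v, w])
    (fun v v' w => A.vecCons_add ![w] v v')
    (fun c v w => A.vecCons_smul ![w] c v)
    (fun v w w' => by
      rw [hswap, hswap v w, hswap v w', ← neg_add]
      exact congrArg _ (A.vecCons_add ![v] w w'))
    (fun c v w => by
      rw [hswap, hswap v w, smul_neg]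
      exact congrArg _ (A.vecCons_smul ![v] c w))

theorem alternatingBilin_apply (A : J1 [⋀^Fin 2]→L[ℝ] ℝ) (v w : J1) :
    alternatingBilin A v w = A ![v, w] := rfl

theorem alternatingBilin_self (A : J1 [⋀^Fin 2]→L[ℝ] ℝ) (v : J1) :
    alternatingBilin A v v = 0 :=
  A.map_eq_zero_of_eq (v := ![v, v]) (i := 0) (j := 1) rfl (by simp)

theorem alternatingBilin_swap (A : J1 [⋀^Fin 2]→L[ℝ] ℝ) (v w : J1) :
    alternatingBilin A v w = -alternatingBilin A w v := by
  have h := alternatingBilin_self A (v + w)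
  simp only [map_add, LinearMap.add_apply, alternatingBilin_self] at h
  linarith

theorem contDiffOn_twoForm_apply {ρ : TwoForm} {W : Set J1} (hρ : ContDiffOn ℝ ∞ ρ W)
    {v w : J1 → J1} (hv : ContDiffOn ℝ ∞ v W) (hw : ContDiffOn ℝ ∞ w W) :
    ContDiffOn ℝ ∞ (fun θ => ρ θ ![v θ, w θ]) W := by
  have hdec : ∀ x : J1, x = ∑ k, x k • Pi.single k (1 : ℝ) := fun x => by
    ext m
    simp [Finset.sum_apply, Pi.single_apply]
  have hexp : ∀ θ, ρ θ ![v θ, w θ] =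
      ∑ k, ∑ l, v θ k * (w θ l * ρ θ ![Pi.single k 1, Pi.single l 1]) := by
    intro θ
    rw [← alternatingBilin_apply]
    conv_lhs => rw [hdec (v θ), hdec (w θ)]
    simp only [map_sum, LinearMap.sum_apply, map_smul, LinearMap.smul_apply, smul_eq_mul,
      alternatingBilin_apply, Finset.mul_sum]
    rw [Finset.sum_comm]
    refine Finset.sum_congr rfl fun k _ => Finset.sum_congr rfl fun l _ => by ring
  simp only [hexp]
  have hev : ∀ m : Fin 2 → J1, ContDiffOn ℝ ∞ (fun θ => ρ θ m) W := fun m =>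
    ((ContinuousMultilinearMap.apply ℝ (fun _ : Fin 2 => J1) ℝ m).comp
      (ContinuousAlternatingMap.toContinuousMultilinearMapCLM ℝ)).contDiff.comp_contDiffOn hρ
  exact ContDiffOn.sum fun k _ => ContDiffOn.sum fun l _ =>
    (contDiffOn_pi.1 hv k).mul ((contDiffOn_pi.1 hw l).mul (hev _))

end TwoForms

/-! ### The Pfaffian, its double root and the Lagrangian radical. -/

section Parabolic

/-- The frame of the contact distribution dual to `dx, dy, dp, dq`. -/
def contactFrame (θ : J1) : Fin 4 → J1 :=
  ![contactVector θ 1 0 0 0, contactVector θ 0 1 0 0, contactVector θ 0 0 1 0,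
    contactVector θ 0 0 0 1]

/-- The coefficients of a 2-form on the contact distribution. -/
def contactCoeff (ρ : TwoForm) (i j : Fin 4) (θ : J1) : ℝ :=
  ρ θ ![contactFrame θ i, contactFrame θ j]

theorem contDiffOn_contactFrame (W : Set J1) (i : Fin 4) :
    ContDiffOn ℝ ∞ (fun θ => contactFrame θ i) W := by
  fin_cases i <;>
  exact contDiffOn_contactVector contDiffOn_const contDiffOn_const contDiffOn_const
    contDiffOn_const

theorem contDiffOn_contactCoeff {ρ : TwoForm} {W : Set J1} (hρ : ContDiffOn ℝ ∞ ρ W)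
    (i j : Fin 4) : ContDiffOn ℝ ∞ (contactCoeff ρ i j) W :=
  contDiffOn_twoForm_apply hρ (contDiffOn_contactFrame W i) (contDiffOn_contactFrame W j)

/-- The frame indices 2 and 3 stand for p and q, which are the coordinates 3 and 4 of `J1`. -/
theorem twoForm_apply_of_mem_contact (ρ : TwoForm) {θ v w : J1} (hv : v ∈ contactDistribution θ)
    (hw : w ∈ contactDistribution θ) :
    ρ θ ![v, w] = contactCoeff ρ 0 1 θ * (v 0 * w 1 - v 1 * w 0)
      + contactCoeff ρ 0 2 θ * (v 0 * w 3 - v 3 * w 0)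
      + contactCoeff ρ 0 3 θ * (v 0 * w 4 - v 4 * w 0)
      + contactCoeff ρ 1 2 θ * (v 1 * w 3 - v 3 * w 1)
      + contactCoeff ρ 1 3 θ * (v 1 * w 4 - v 4 * w 1)
      + contactCoeff ρ 2 3 θ * (v 3 * w 4 - v 4 * w 3) := by
  have hd : ∀ i j, contactCoeff ρ i j θ =
    alternatingBilin (ρ θ) (contactFrame θ i) (contactFrame θ j) := fun i j => rfl
  have hf : ∀ a b c d, contactVector θ a b c d = a • contactFrame θ 0 + b • contactFrame θ 1
    + c • contactFrame θ 2 + d • contactFrame θ 3 := contactVector_combination θ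
  rw [← alternatingBilin_apply]
  conv_lhs => rw [eq_contactVector hv, eq_contactVector hw, hf, hf]
  simp only [hd, map_add, map_smul, LinearMap.add_apply, LinearMap.smul_apply, smul_eq_mul,
    alternatingBilin_self]
  rw [alternatingBilin_swap _ (contactFrame θ 1) (contactFrame θ 0),
    alternatingBilin_swap _ (contactFrame θ 2) (contactFrame θ 0),
    alternatingBilin_swap _ (contactFrame θ 3) (contactFrame θ 0),
    alternatingBilin_swap _ (contactFrame θ 2) (contactFrame θ 1),
    alternatingBilin_swap _ (contactFrame θ 3) (contactFrame θ 1),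
    alternatingBilin_swap _ (contactFrame θ 3) (contactFrame θ 2)]
  ring

/-- The four equations are the pairings with the four frame vectors; dU contributes c to the
coefficients of dx ∧ dp and dy ∧ dq only. -/
theorem mem_radicalOnContact {ρ : TwoForm} {c : ℝ} {θ v : J1} :
    v ∈ radicalOnContact ρ c θ ↔ v ∈ contactDistribution θ ∧
      contactCoeff ρ 0 1 θ * v 1 + (contactCoeff ρ 0 2 θ + c) * v 3
        + contactCoeff ρ 0 3 θ * v 4 = 0 ∧
      -contactCoeff ρ 0 1 θ * v 0 + contactCoeff ρ 1 2 θ * v 3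
        + (contactCoeff ρ 1 3 θ + c) * v 4 = 0 ∧
      -(contactCoeff ρ 0 2 θ + c) * v 0 - contactCoeff ρ 1 2 θ * v 1
        + contactCoeff ρ 2 3 θ * v 4 = 0 ∧
      -contactCoeff ρ 0 3 θ * v 0 - (contactCoeff ρ 1 3 θ + c) * v 1
        - contactCoeff ρ 2 3 θ * v 3 = 0 := by
  refine and_congr_right fun hv => ⟨fun h => ?_, fun ⟨h0, h1, h2, h3⟩ w hw => ?_⟩
  · have h0 := h _ (contactVector_mem θ 1 0 0 0)
    have h1 := h _ (contactVector_mem θ 0 1 0 0)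
    have h2 := h _ (contactVector_mem θ 0 0 1 0)
    have h3 := h _ (contactVector_mem θ 0 0 0 1)
    rw [twoForm_apply_of_mem_contact ρ hv (contactVector_mem _ _ _ _ _)] at h0 h1 h2 h3
    simp [contactVector, dContactForm] at h0 h1 h2 h3
    exact ⟨by linarith, by linarith, by linarith, by linarith⟩
  · rw [twoForm_apply_of_mem_contact ρ hv hw, dContactForm]
    linear_combination -w 0 * h0 - w 1 * h1 - w 3 * h2 - w 4 * h3

/-- The Pfaffian of `ρ + c dU` on the contact distribution. -/
def contactPfaffian (ρ : TwoForm) (θ : J1) (c : ℝ) : ℝ :=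
  contactCoeff ρ 0 1 θ * contactCoeff ρ 2 3 θ
    - (contactCoeff ρ 0 2 θ + c) * (contactCoeff ρ 1 3 θ + c)
    + contactCoeff ρ 0 3 θ * contactCoeff ρ 1 2 θ

/-- The Pfaffian adjoint of a skew 4 × 4 matrix times the matrix is the Pfaffian times the identity,
up to sign; a non-zero kernel vector therefore forces the Pfaffian to vanish. -/
theorem contactPfaffian_eq_zero {ρ : TwoForm} {θ : J1} {c : ℝ}
    (h : radicalOnContact ρ c θ ≠ ⊥) : contactPfaffian ρ θ c = 0 := by
  obtain ⟨v, hv, hv0⟩ := Submodule.exists_mem_ne_zero_of_ne_bot h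
  obtain ⟨hvC, h0, h1, h2, h3⟩ := mem_radicalOnContact.1 hv
  by_contra hP
  have e0 : contactPfaffian ρ θ c * v 0 = 0 := by
    rw [contactPfaffian]
    linear_combination -contactCoeff ρ 2 3 θ * h1 + (contactCoeff ρ 1 3 θ + c) * h2
      - contactCoeff ρ 1 2 θ * h3
  have e1 : contactPfaffian ρ θ c * v 1 = 0 := by
    rw [contactPfaffian]
    linear_combination contactCoeff ρ 2 3 θ * h0 - contactCoeff ρ 0 3 θ * h2
      + (contactCoeff ρ 0 2 θ + c) * h3
  have e3 : contactPfaffian ρ θ c * v 3 = 0 := by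
    rw [contactPfaffian]
    linear_combination -(contactCoeff ρ 1 3 θ + c) * h0 + contactCoeff ρ 0 3 θ * h1
      - contactCoeff ρ 0 1 θ * h3
  have e4 : contactPfaffian ρ θ c * v 4 = 0 := by
    rw [contactPfaffian]
    linear_combination contactCoeff ρ 1 2 θ * h0 - (contactCoeff ρ 0 2 θ + c) * h1
      + contactCoeff ρ 0 1 θ * h2
  apply hv0
  rw [eq_contactVector hvC, (mul_eq_zero.1 e0).resolve_left hP, (mul_eq_zero.1 e1).resolve_left hP,
    (mul_eq_zero.1 e3).resolve_left hP, (mul_eq_zero.1 e4).resolve_left hP]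
  ext k; fin_cases k <;> simp [contactVector]

/-- The rows of the Pfaffian adjoint span the radical of a degenerate form. -/
theorem contactVector_mem_radical {ρ : TwoForm} {θ : J1} {c : ℝ}
    (h : contactPfaffian ρ θ c = 0) :
    contactVector θ 0 (contactCoeff ρ 2 3 θ) (-(contactCoeff ρ 1 3 θ + c))
      (contactCoeff ρ 1 2 θ) ∈ radicalOnContact ρ c θ ∧
    contactVector θ (-contactCoeff ρ 2 3 θ) 0 (contactCoeff ρ 0 3 θ)
      (-(contactCoeff ρ 0 2 θ + c)) ∈ radicalOnContact ρ c θ ∧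
    contactVector θ (contactCoeff ρ 1 3 θ + c) (-contactCoeff ρ 0 3 θ) 0
      (contactCoeff ρ 0 1 θ) ∈ radicalOnContact ρ c θ ∧
    contactVector θ (-contactCoeff ρ 1 2 θ) (contactCoeff ρ 0 2 θ + c) (-contactCoeff ρ 0 1 θ)
      0 ∈ radicalOnContact ρ c θ := by
  rw [contactPfaffian] at h
  simp only [mem_radicalOnContact, contactVector_mem, true_and]
  simp only [contactVector, Matrix.cons_val]
  refine ⟨⟨?_, ?_, ?_, ?_⟩, ⟨?_, ?_, ?_, ?_⟩, ⟨?_, ?_, ?_, ?_⟩, ⟨?_, ?_, ?_, ?_⟩⟩ <;>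
  first
  | linear_combination h
  | linear_combination -h
  | ring1

/-- If every row of the Pfaffian adjoint is zero, so are all coefficients of the form, and its
radical is the whole contact space. -/
theorem radicalOnContact_ne_bot {ρ : TwoForm} {θ : J1} {c : ℝ}
    (h : contactPfaffian ρ θ c = 0) : radicalOnContact ρ c θ ≠ ⊥ := by
  intro hbot
  obtain ⟨h0, h1, h2, h3⟩ := contactVector_mem_radical h
  have hz : ∀ {v : J1}, v ∈ radicalOnContact ρ c θ → v = 0 := fun hv => by rwa [hbot] at hv
  have a23 := congrFun (hz h0) 1
  have a13 := congrFun (hz h0) 3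
  have a12 := congrFun (hz h0) 4
  have a03 := congrFun (hz h1) 3
  have a02 := congrFun (hz h1) 4
  have a01 := congrFun (hz h2) 4
  simp only [contactVector, Matrix.cons_val, Pi.zero_apply, neg_eq_zero]
    at a23 a13 a12 a03 a02 a01
  have : contactVector θ 1 0 0 0 ∈ radicalOnContact ρ c θ := by
    refine mem_radicalOnContact.2 ⟨contactVector_mem _ _ _ _ _, ?_⟩
    simp [contactVector, a23, a13, a12, a03, a02, a01]
  simpa [contactVector] using congrFun (hz this) 0

/-- The value of `c` for which `ρ + c dU` is degenerate in the parabolic case. -/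
noncomputable def parabolicRoot (ρ : TwoForm) (θ : J1) : ℝ :=
  -(contactCoeff ρ 0 2 θ + contactCoeff ρ 1 3 θ) / 2

variable {ρ : TwoForm} {W : Set J1}

/-- The roots of the Pfaffian add up to -(a₀₂ + a₁₃), where a_ij is `contactCoeff ρ i j`. The other
root also gives a degenerate form, so by uniqueness both roots equal the midpoint `parabolicRoot`.
-/
theorem IsParabolic.contactPfaffian_eq_zero (h : IsParabolic ρ W) {θ : J1} (hθ : θ ∈ W) :
    contactPfaffian ρ θ (parabolicRoot ρ θ) = 0 := by
  obtain ⟨c, hc, huniq⟩ := (h θ hθ).2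
  have h1 := _root_.contactPfaffian_eq_zero hc
  have h2 : contactPfaffian ρ θ (-(contactCoeff ρ 0 2 θ + contactCoeff ρ 1 3 θ) - c) = 0 := by
    rw [← h1, contactPfaffian, contactPfaffian]; ring
  have h3 := huniq _ (radicalOnContact_ne_bot h2)
  have h4 : parabolicRoot ρ θ = c := by rw [parabolicRoot]; linarith
  rw [h4, h1]

theorem IsParabolic.characteristicDistribution_eq (h : IsParabolic ρ W) {θ : J1} (hθ : θ ∈ W) :
    characteristicDistribution ρ θ = radicalOnContact ρ (parabolicRoot ρ θ) θ := by
  obtain ⟨c, hc, huniq⟩ := (h θ hθ).2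
  have hroot := huniq _ (radicalOnContact_ne_bot (h.contactPfaffian_eq_zero hθ))
  rw [hroot]
  refine le_antisymm (iSup_le fun c' => ?_) (le_iSup (fun c => radicalOnContact ρ c θ) c)
  by_cases hc' : radicalOnContact ρ c' θ = ⊥
  · rw [hc']; exact bot_le
  · rw [huniq c' hc']

theorem radicalOnContact_le_characteristicDistribution (ρ : TwoForm) (c : ℝ) (θ : J1) :
    radicalOnContact ρ c θ ≤ characteristicDistribution ρ θ :=
  le_iSup (fun c => radicalOnContact ρ c θ) c

/-- In the parabolic case some coefficient of the degenerate form which is not a coefficient of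
`dU` does not vanish. -/
theorem IsParabolic.exists_contactCoeff_ne_zero (h : IsParabolic ρ W) {θ : J1} (hθ : θ ∈ W) :
    contactCoeff ρ 0 1 θ ≠ 0 ∨ contactCoeff ρ 0 3 θ ≠ 0 ∨ contactCoeff ρ 1 2 θ ≠ 0 ∨
      contactCoeff ρ 2 3 θ ≠ 0 := by
  by_contra! hz
  obtain ⟨h01, h03, h12, h23⟩ := hz
  have hP := h.contactPfaffian_eq_zero hθ
  rw [contactPfaffian, h01, h03, parabolicRoot] at hP
  -- The Pfaffian at the midpoint has become (a₀₂ - a₁₃)²/4; its vanishing makes ρ a multiple of dU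
  -- on the contact space.
  have hsq : contactCoeff ρ 0 2 θ - contactCoeff ρ 1 3 θ = 0 := by
    have : (contactCoeff ρ 0 2 θ - contactCoeff ρ 1 3 θ) ^ 2 = 0 := by linarith
    exact pow_eq_zero_iff (two_ne_zero) |>.1 this
  obtain ⟨v, hv, w, hw, hne⟩ := (h θ hθ).1 (-contactCoeff ρ 1 3 θ)
  apply hne
  rw [twoForm_apply_of_mem_contact ρ hv hw, dContactForm, h01, h03, h12, h23]
  linear_combination (v 0 * w 3 - v 3 * w 0) * hsq

theorem IsParabolic.le_contactDistribution (h : IsParabolic ρ W) {θ : J1} (hθ : θ ∈ W) :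
    characteristicDistribution ρ θ ≤ contactDistribution θ := by
  rw [h.characteristicDistribution_eq hθ]
  exact fun v hv => hv.1

/-- The characteristic distribution is isotropic. -/
theorem IsParabolic.isotropic (h : IsParabolic ρ W) {θ : J1} (hθ : θ ∈ W) :
    ∀ v ∈ characteristicDistribution ρ θ, ∀ w ∈ characteristicDistribution ρ θ,
      dContactForm v w = 0 := by
  rw [h.characteristicDistribution_eq hθ]
  intro v hv w hw
  obtain ⟨-, v0, v1, v2, v3⟩ := mem_radicalOnContact.1 hv
  obtain ⟨-, w0, w1, w2, w3⟩ := mem_radicalOnContact.1 hw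
  rw [parabolicRoot] at v0 v1 v2 v3 w0 w1 w2 w3
  rw [dContactForm]
  -- At the midpoint dx ∧ dp and dy ∧ dq have opposite coefficients. This makes each of the four
  -- other coefficients, times dU(v, w), a combination of the radical equations of v and w.
  rcases h.exists_contactCoeff_ne_zero hθ with hne | hne | hne | hne <;>
    refine mul_left_cancel₀ hne ?_
  · linear_combination w 4 * v0 - w 3 * v1 - v 4 * w0 + v 3 * w1
  · linear_combination -w 1 * v0 - w 3 * v3 + v 1 * w0 + v 3 * w3
  · linear_combination -w 0 * v1 - w 4 * v2 + v 0 * w1 + v 4 * w2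
  · linear_combination w 0 * v3 - w 1 * v2 - v 0 * w3 + v 1 * w2

end Parabolic

/-! ### Local frames and the rank of the characteristic distribution. -/

section Frame

variable {ρ : TwoForm} {W : Set J1}

/-- Two sections of the characteristic distribution in normal form near a point. -/
theorem exists_frame_of_sections {P : TangentField} (hW : IsOpen W) {R R' : J1 → J1}
    {α : J1 → ℝ} (hR : ContDiffOn ℝ ∞ R W) (hR' : ContDiffOn ℝ ∞ R' W)
    (hα : ContDiffOn ℝ ∞ α W) (hRP : ∀ η ∈ W, R η ∈ P η ∧ R' η ∈ P η) {i j : Fin 5}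
    (hval : ∀ η, R η i = -α η ∧ R η j = 0 ∧ R' η i = 0 ∧ R' η j = α η)
    {θ : J1} (hθ : θ ∈ W) (hne : α θ ≠ 0) :
    ∃ (V : Set J1) (X Y : J1 → J1), IsOpen V ∧ θ ∈ V ∧ V ⊆ W ∧ ContDiffOn ℝ ∞ X V ∧
      ContDiffOn ℝ ∞ Y V ∧ ∀ η ∈ V, (X η ∈ P η ∧ Y η ∈ P η) ∧
        X η i = 1 ∧ X η j = 0 ∧ Y η i = 0 ∧ Y η j = 1 := by
  have hV : IsOpen (W ∩ α ⁻¹' {0}ᶜ) :=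
    hα.continuousOn.isOpen_inter_preimage hW isOpen_compl_singleton
  have hinv : ContDiffOn ℝ ∞ (fun η => (α η)⁻¹) (W ∩ α ⁻¹' {0}ᶜ) :=
    (hα.mono Set.inter_subset_left).inv fun η hη => hη.2
  refine ⟨W ∩ α ⁻¹' {0}ᶜ, fun η => -(α η)⁻¹ • R η, fun η => (α η)⁻¹ • R' η, hV, ⟨hθ, hne⟩,
    Set.inter_subset_left, hinv.neg.smul (hR.mono Set.inter_subset_left),
    hinv.smul (hR'.mono Set.inter_subset_left), fun η hη => ?_⟩
  obtain ⟨h1, h2, h3, h4⟩ := hval η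
  have hη' : α η ≠ 0 := hη.2
  refine ⟨⟨Submodule.smul_mem _ _ (hRP η hη.1).1, Submodule.smul_mem _ _ (hRP η hη.1).2⟩, ?_⟩
  simp [h1, h2, h3, h4, hη']

theorem contDiffOn_parabolicRoot (hρ : ContDiffOn ℝ ∞ ρ W) :
    ContDiffOn ℝ ∞ (parabolicRoot ρ) W :=
  ((contDiffOn_contactCoeff hρ 0 2).add (contDiffOn_contactCoeff hρ 1 3)).neg.div_const 2

/-- The frame consists of two rows of the Pfaffian adjoint divided by ± a non-zero coefficient; i
and j are the coordinates complementary to the two indices of that coefficient. -/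
theorem IsParabolic.exists_frame (h : IsParabolic ρ W) (hW : IsOpen W)
    (hρ : ContDiffOn ℝ ∞ ρ W) {θ : J1} (hθ : θ ∈ W) :
    ∃ (i j : Fin 5) (V : Set J1) (X Y : J1 → J1), i ≠ j ∧ IsOpen V ∧ θ ∈ V ∧ V ⊆ W ∧
      ContDiffOn ℝ ∞ X V ∧ ContDiffOn ℝ ∞ Y V ∧ ∀ η ∈ V,
        (X η ∈ characteristicDistribution ρ η ∧ Y η ∈ characteristicDistribution ρ η) ∧
        X η i = 1 ∧ X η j = 0 ∧ Y η i = 0 ∧ Y η j = 1 := by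
  have hmem := fun η (hη : η ∈ W) => contactVector_mem_radical (h.contactPfaffian_eq_zero hη)
  have hD := fun η (_ : η ∈ W) =>
    radicalOnContact_le_characteristicDistribution ρ (parabolicRoot ρ η) η
  have hc := contDiffOn_contactCoeff hρ
  have hr := contDiffOn_parabolicRoot hρ
  have h0 : ContDiffOn ℝ ∞ (fun _ : J1 => (0 : ℝ)) W := contDiffOn_const
  have s0 := contDiffOn_contactVector h0 (hc 2 3) ((hc 1 3).add hr).neg (hc 1 2)
  have s1 := contDiffOn_contactVector (hc 2 3).neg h0 (hc 0 3) ((hc 0 2).add hr).neg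
  have s2 := contDiffOn_contactVector ((hc 1 3).add hr) (hc 0 3).neg h0 (hc 0 1)
  have s3 := contDiffOn_contactVector (hc 1 2).neg ((hc 0 2).add hr) (hc 0 1).neg h0
  rcases h.exists_contactCoeff_ne_zero hθ with hne | hne | hne | hne
  · exact ⟨3, 4, (exists_frame_of_sections hW s3 s2 (hc 0 1)
      (fun η hη => ⟨hD η hη (hmem η hη).2.2.2, hD η hη (hmem η hη).2.2.1⟩) (i := 3) (j := 4)
      (fun η => by simp [contactVector]) hθ hne).imp fun V ⟨X, Y, hV⟩ => ⟨X, Y, by decide, hV⟩⟩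
  · exact ⟨1, 3, (exists_frame_of_sections hW s2 s1 (hc 0 3)
      (fun η hη => ⟨hD η hη (hmem η hη).2.2.1, hD η hη (hmem η hη).2.1⟩) (i := 1) (j := 3)
      (fun η => by simp [contactVector]) hθ hne).imp fun V ⟨X, Y, hV⟩ => ⟨X, Y, by decide, hV⟩⟩
  · exact ⟨0, 4, (exists_frame_of_sections hW s3 s0 (hc 1 2)
      (fun η hη => ⟨hD η hη (hmem η hη).2.2.2, hD η hη (hmem η hη).1⟩) (i := 0) (j := 4)
      (fun η => by simp [contactVector]) hθ hne).imp fun V ⟨X, Y, hV⟩ => ⟨X, Y, by decide, hV⟩⟩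
  · exact ⟨0, 1, (exists_frame_of_sections hW s1 s0 (hc 2 3)
      (fun η hη => ⟨hD η hη (hmem η hη).2.1, hD η hη (hmem η hη).1⟩) (i := 0) (j := 1)
      (fun η => by simp [contactVector]) hθ hne).imp fun V ⟨X, Y, hV⟩ => ⟨X, Y, by decide, hV⟩⟩

/-- A two-dimensional space containing vectors in normal form is parametrized by the two
coordinates. -/
theorem eq_smul_add_smul_of_finrank_le_two {N : Submodule ℝ J1} (hN : Module.finrank ℝ N ≤ 2)
    {x y : J1} (hx : x ∈ N) (hy : y ∈ N) {i j : Fin 5} (hxi : x i = 1) (hxj : x j = 0)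
    (hyi : y i = 0) (hyj : y j = 1) {v : J1} (hv : v ∈ N) : v = v i • x + v j • y := by
  let T : N →ₗ[ℝ] ℝ × ℝ :=
    ((LinearMap.proj i).prod (LinearMap.proj j) : J1 →ₗ[ℝ] ℝ × ℝ).domRestrict N
  have hTsurj : Function.Surjective T := by
    rintro ⟨s, t⟩
    refine ⟨⟨s • x + t • y, N.add_mem (N.smul_mem _ hx) (N.smul_mem _ hy)⟩, ?_⟩
    simp [T, hxi, hxj, hyi, hyj]
  have hdim : Module.finrank ℝ N = Module.finrank ℝ (ℝ × ℝ) := by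
    have h1 := LinearMap.finrank_le_finrank_of_surjective hTsurj
    have h2 : Module.finrank ℝ (ℝ × ℝ) = 2 := by simp
    omega
  have hTinj := (LinearMap.injective_iff_surjective_of_finrank_eq_finrank hdim).2 hTsurj
  have : (⟨v, hv⟩ : N) = ⟨v i • x + v j • y, N.add_mem (N.smul_mem _ hx) (N.smul_mem _ hy)⟩ := by
    apply hTinj
    simp [T, hxi, hxj, hyi, hyj]
  exact congrArg Subtype.val this

theorem two_le_finrank {N : Submodule ℝ J1}
    {x y : J1} (hx : x ∈ N) (hy : y ∈ N) {i j : Fin 5} (hxi : x i = 1) (hxj : x j = 0)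
    (hyi : y i = 0) (hyj : y j = 1) : 2 ≤ Module.finrank ℝ N := by
  let T : N →ₗ[ℝ] ℝ × ℝ :=
    ((LinearMap.proj i).prod (LinearMap.proj j) : J1 →ₗ[ℝ] ℝ × ℝ).domRestrict N
  have hTsurj : Function.Surjective T := by
    rintro ⟨s, t⟩
    refine ⟨⟨s • x + t • y, N.add_mem (N.smul_mem _ hx) (N.smul_mem _ hy)⟩, ?_⟩
    simp [T, hxi, hxj, hyi, hyj]
  have h1 := LinearMap.finrank_le_finrank_of_surjective hTsurj
  have h2 : Module.finrank ℝ (ℝ × ℝ) = 2 := by simp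
  omega

theorem IsParabolic.finrank_characteristicDistribution (h : IsParabolic ρ W) (hW : IsOpen W)
    (hρ : ContDiffOn ℝ ∞ ρ W) {θ : J1} (hθ : θ ∈ W) :
    Module.finrank ℝ (characteristicDistribution ρ θ) = 2 := by
  obtain ⟨i, j, V, X, Y, -, -, hθV, -, -, -, hXY⟩ := h.exists_frame hW hρ hθ
  obtain ⟨⟨hX, hY⟩, h1, h2, h3, h4⟩ := hXY θ hθV
  exact le_antisymm (finrank_le_two_of_isotropic (h.le_contactDistribution hθ) (h.isotropic hθ))
    (two_le_finrank hX hY h1 h2 h3 h4)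

/-- The characteristic distribution is Lagrangian. -/
theorem IsParabolic.mem_of_orthogonal (h : IsParabolic ρ W) (hW : IsOpen W)
    (hρ : ContDiffOn ℝ ∞ ρ W) {θ : J1} (hθ : θ ∈ W) {v : J1} (hv : v ∈ contactDistribution θ)
    (hvD : ∀ w ∈ characteristicDistribution ρ θ, dContactForm v w = 0) :
    v ∈ characteristicDistribution ρ θ :=
  mem_of_isotropic (h.le_contactDistribution hθ) (h.isotropic hθ)
    (h.finrank_characteristicDistribution hW hρ hθ) hv hvD

/-- Every characteristic vector extends to a local section. -/
theorem IsParabolic.exists_localSection (h : IsParabolic ρ W) (hW : IsOpen W)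
    (hρ : ContDiffOn ℝ ∞ ρ W) {θ : J1} (hθ : θ ∈ W) {v : J1}
    (hv : v ∈ characteristicDistribution ρ θ) :
    ∃ X, IsLocalSection (characteristicDistribution ρ) θ X ∧ X θ = v := by
  obtain ⟨i, j, V, X, Y, -, hV, hθV, -, hX, hY, hXY⟩ := h.exists_frame hW hρ hθ
  obtain ⟨⟨hXm, hYm⟩, h1, h2, h3, h4⟩ := hXY θ hθV
  refine ⟨fun η => v i • X η + v j • Y η, ⟨V, hV, hθV, (hX.const_smul _).add (hY.const_smul _),
    fun η hη => Submodule.add_mem _ (Submodule.smul_mem _ _ (hXY η hη).1.1)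
      (Submodule.smul_mem _ _ (hXY η hη).1.2)⟩, ?_⟩
  exact (eq_smul_add_smul_of_finrank_le_two
    (h.finrank_characteristicDistribution hW hρ hθ).le hXm hYm h1 h2 h3 h4 hv).symm

end Frame

/-! ### Derived distributions and brackets. -/

section Derived

variable {P : TangentField} {θ : J1}

theorem IsLocalSection.contDiffAt {X : J1 → J1} (h : IsLocalSection P θ X) :
    ContDiffAt ℝ ∞ X θ := by
  obtain ⟨V, hV, hθ, hX, -⟩ := h
  exact hX.contDiffAt (hV.mem_nhds hθ)

theorem IsLocalSection.eventually_mem {X : J1 → J1} (h : IsLocalSection P θ X) :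
    ∀ᶠ η in 𝓝 θ, X η ∈ P η := by
  obtain ⟨V, hV, hθ, -, hX⟩ := h
  filter_upwards [hV.mem_nhds hθ] with η hη using hX η hη

theorem IsLocalSection.congr {P' : TangentField} {X : J1 → J1} (h : IsLocalSection P θ X)
    {W : Set J1} (hW : IsOpen W) (hθ : θ ∈ W) (hPP' : ∀ η ∈ W, P η ≤ P' η) :
    IsLocalSection P' θ X := by
  obtain ⟨V, hV, hθV, hX, hXP⟩ := h
  exact ⟨V ∩ W, hV.inter hW, ⟨hθV, hθ⟩, hX.mono Set.inter_subset_left,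
    fun η hη => hPP' η hη.2 (hXP η hη.1)⟩

theorem le_derivedDistribution (P : TangentField) (θ : J1) : P θ ≤ derivedDistribution P θ :=
  le_sup_left

theorem lieBracket_mem_derivedDistribution {X Y : J1 → J1} (hX : IsLocalSection P θ X)
    (hY : IsLocalSection P θ Y) :
    VectorField.lieBracket ℝ X Y θ ∈ derivedDistribution P θ :=
  le_sup_right (a := P θ) (Submodule.subset_span ⟨X, Y, hX, hY, rfl⟩)

theorem derivedDistribution_le {N : Submodule ℝ J1} (h : P θ ≤ N)
    (hb : ∀ X Y, IsLocalSection P θ X → IsLocalSection P θ Y →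
      VectorField.lieBracket ℝ X Y θ ∈ N) : derivedDistribution P θ ≤ N := by
  refine sup_le h (Submodule.span_le.2 ?_)
  rintro u ⟨X, Y, hX, hY, rfl⟩
  exact hb X Y hX hY

theorem derivedDistribution_congr {P' : TangentField} {W : Set J1} (hW : IsOpen W) (hθ : θ ∈ W)
    (hPP' : ∀ η ∈ W, P η = P' η) : derivedDistribution P θ = derivedDistribution P' θ := by
  apply le_antisymm
  · exact derivedDistribution_le ((hPP' θ hθ).le.trans (le_derivedDistribution _ _))
      fun X Y hX hY => lieBracket_mem_derivedDistribution
        (hX.congr hW hθ fun η hη => (hPP' η hη).le) (hY.congr hW hθ fun η hη => (hPP' η hη).le)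
  · exact derivedDistribution_le ((hPP' θ hθ).ge.trans (le_derivedDistribution _ _))
      fun X Y hX hY => lieBracket_mem_derivedDistribution
        (hX.congr hW hθ fun η hη => (hPP' η hη).ge) (hY.congr hW hθ fun η hη => (hPP' η hη).ge)

/-- The bracket of local sections is a local section of the derived distribution. -/
theorem IsLocalSection.lieBracket {X Y : J1 → J1} (hX : IsLocalSection P θ X)
    (hY : IsLocalSection P θ Y) :
    IsLocalSection (derivedDistribution P) θ (VectorField.lieBracket ℝ X Y) := by
  obtain ⟨V, hV, hθV, hXs, hXP⟩ := hX
  obtain ⟨V', hV', hθV', hYs, hYP⟩ := hY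
  refine ⟨V ∩ V', hV.inter hV', ⟨hθV, hθV'⟩, fun η hη => ?_, fun η hη => ?_⟩
  · exact ((hXs.contDiffAt (hV.mem_nhds hη.1)).lieBracket_vectorField
      (hYs.contDiffAt (hV'.mem_nhds hη.2)) (by simp)).contDiffWithinAt
  · exact lieBracket_mem_derivedDistribution ⟨V, hV, hη.1, hXs, hXP⟩ ⟨V', hV', hη.2, hYs, hYP⟩

theorem IsLocalSection.add {X Y : J1 → J1} (hX : IsLocalSection P θ X)
    (hY : IsLocalSection P θ Y) : IsLocalSection P θ (fun η => X η + Y η) := by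
  obtain ⟨V, hV, hθV, hXs, hXP⟩ := hX
  obtain ⟨V', hV', hθV', hYs, hYP⟩ := hY
  exact ⟨V ∩ V', hV.inter hV', ⟨hθV, hθV'⟩,
    (hXs.mono Set.inter_subset_left).add (hYs.mono Set.inter_subset_right),
    fun η hη => Submodule.add_mem _ (hXP η hη.1) (hYP η hη.2)⟩

theorem IsLocalSection.const_smul {X : J1 → J1} (hX : IsLocalSection P θ X) (c : ℝ) :
    IsLocalSection P θ (fun η => c • X η) := by
  obtain ⟨V, hV, hθV, hXs, hXP⟩ := hX
  exact ⟨V, hV, hθV, hXs.const_smul c, fun η hη => Submodule.smul_mem _ _ (hXP η hη)⟩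

/-- If all vectors of `P` at `θ` extend to local sections then so do those of `P'`. -/
theorem exists_localSection_derivedDistribution
    (hP : ∀ v ∈ P θ, ∃ X, IsLocalSection P θ X ∧ X θ = v) :
    ∀ v ∈ derivedDistribution P θ, ∃ X, IsLocalSection (derivedDistribution P) θ X ∧ X θ = v := by
  -- The values at θ of local sections of P' form a subspace; it contains P θ and all brackets,
  -- hence all of P' θ.
  let N : Submodule ℝ J1 :=
    { carrier := {v | ∃ X, IsLocalSection (derivedDistribution P) θ X ∧ X θ = v}
      zero_mem' := ⟨fun _ => 0, ⟨Set.univ, isOpen_univ, trivial, contDiffOn_const,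
        fun η _ => Submodule.zero_mem _⟩, rfl⟩
      add_mem' := by
        rintro _ _ ⟨X, hX, rfl⟩ ⟨Y, hY, rfl⟩
        exact ⟨_, hX.add hY, rfl⟩
      smul_mem' := by
        rintro c _ ⟨X, hX, rfl⟩
        exact ⟨_, hX.const_smul c, rfl⟩ }
  refine derivedDistribution_le (N := N) (fun v hv => ?_) fun X Y hX hY => ⟨_, hX.lieBracket hY, rfl⟩
  obtain ⟨X, hX, rfl⟩ := hP v hv
  exact ⟨X, hX.congr isOpen_univ trivial fun η _ => le_derivedDistribution P η, rfl⟩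

/-- First integrals of a distribution are first integrals of the derived distribution. -/
theorem fderiv_eq_zero_of_mem_derivedDistribution {g : J1 → ℝ} {V : Set J1} (hV : IsOpen V)
    (hθ : θ ∈ V) (hg : ContDiffOn ℝ ∞ g V) (hgP : ∀ η ∈ V, ∀ v ∈ P η, fderiv ℝ g η v = 0) :
    ∀ v ∈ derivedDistribution P θ, fderiv ℝ g θ v = 0 := by
  refine derivedDistribution_le (N := LinearMap.ker (fderiv ℝ g θ : J1 →ₗ[ℝ] ℝ))
    (fun v hv => hgP θ hθ v hv) fun X Y hX hY => ?_
  have hz : ∀ {Z : J1 → J1}, IsLocalSection P θ Z →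
      (fun η => fderiv ℝ g η (Z η)) =ᶠ[𝓝 θ] fun _ => 0 := fun hZ => by
    filter_upwards [hZ.eventually_mem, hV.mem_nhds hθ] with η h1 h2 using hgP η h2 _ h1
  change fderiv ℝ g θ _ = 0
  -- dg([X, Y]) = X(Yg) - Y(Xg), and both Xg and Yg vanish near θ.
  rw [VectorField.fderiv_apply_lieBracket (hg.contDiffAt (hV.mem_nhds hθ)) (by
      rw [minSmoothness_of_isRCLikeNormedField]; exact WithTop.coe_le_coe.2 le_top)
    (hY.contDiffAt.differentiableAt (by simp)) (hX.contDiffAt.differentiableAt (by simp)),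
    (hz hX).fderiv_eq, (hz hY).fderiv_eq]
  simp

/-- The `dz`-component of the derivative of a section of the contact distribution. -/
theorem IsLocalSection.fderiv_apply_two {Z : J1 → J1} (hZ : IsLocalSection contactDistribution θ Z)
    (v : J1) : fderiv ℝ Z θ v 2 = v 3 * Z θ 0 + θ 3 * fderiv ℝ Z θ v 0 + v 4 * Z θ 1
      + θ 4 * fderiv ℝ Z θ v 1 := by
  have hZd := (hZ.contDiffAt.differentiableAt (by simp)).hasFDerivAt
  have hk : ∀ k : Fin 5, HasFDerivAt (fun η => Z η k)
    ((ContinuousLinearMap.proj (R := ℝ) (φ := fun _ : Fin 5 => ℝ) k).comp (fderiv ℝ Z θ)) θ :=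
    fun k => hasFDerivAt_pi'.1 hZd k
  have hc : ∀ k : Fin 5, HasFDerivAt (fun η : J1 => η k)
    (ContinuousLinearMap.proj (R := ℝ) (φ := fun _ : Fin 5 => ℝ) k) θ :=
    fun k => (ContinuousLinearMap.proj (R := ℝ) (φ := fun _ : Fin 5 => ℝ) k).hasFDerivAt
  have h1 := ((hc 3).mul (hk 0)).add ((hc 4).mul (hk 1))
  have heq : (fun η => Z η 2) =ᶠ[𝓝 θ] fun η => η 3 * Z η 0 + η 4 * Z η 1 := by
    filter_upwards [hZ.eventually_mem] with η hη using mem_contactDistribution.1 hη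
  have := congrArg (fun L => L v) ((h1.congr_of_eventuallyEq heq).unique (hk 2))
  simp only [_root_.add_apply, _root_.smul_apply, smul_eq_mul,
    ContinuousLinearMap.comp_apply, ContinuousLinearMap.proj_apply] at this
  linarith

/-- The contact form of a bracket of sections of the contact distribution. -/
theorem contactForm_lieBracket {X Y : J1 → J1} (hX : IsLocalSection contactDistribution θ X)
    (hY : IsLocalSection contactDistribution θ Y) :
    contactForm θ (VectorField.lieBracket ℝ X Y θ) = -dContactForm (X θ) (Y θ) := by
  rw [VectorField.lieBracket_eq, contactForm_apply, dContactForm]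
  simp only [Pi.sub_apply]
  rw [hX.fderiv_apply_two, hY.fderiv_apply_two]
  ring

end Derived

/-! ### Hamiltonian fields on the contact distribution. -/

section Hamiltonian

/-- The hamiltonian field of `f` on the contact distribution. -/
noncomputable def contactHamiltonian (f : J1 → ℝ) (θ : J1) : J1 :=
  contactVector θ (fderiv ℝ f θ (contactFrame θ 2)) (fderiv ℝ f θ (contactFrame θ 3))
    (-fderiv ℝ f θ (contactFrame θ 0)) (-fderiv ℝ f θ (contactFrame θ 1))

variable {f : J1 → ℝ} {V : Set J1} {θ : J1}

theorem contactHamiltonian_mem (f : J1 → ℝ) (θ : J1) :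
    contactHamiltonian f θ ∈ contactDistribution θ := contactVector_mem _ _ _ _ _

theorem eq_contactVector_add (θ v : J1) :
    v = contactVector θ (v 0) (v 1) (v 3) (v 4) + contactForm θ v • Pi.single 2 1 := by
  ext k
  fin_cases k <;> simp [contactVector, contactForm_apply]

theorem map_contactVector (L : J1 →L[ℝ] ℝ) (θ : J1) (a b c d : ℝ) :
    L (contactVector θ a b c d) = a * L (contactFrame θ 0) + b * L (contactFrame θ 1)
      + c * L (contactFrame θ 2) + d * L (contactFrame θ 3) := by
  rw [contactVector_combination]
  simp only [map_add, map_smul, smul_eq_mul]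
  rfl

/-- On 𝒞 the field represents df through dU. The correction term is forced by ∂_z, which dU kills
and df need not. -/
theorem dContactForm_contactHamiltonian (f : J1 → ℝ) (θ v : J1) :
    dContactForm (contactHamiltonian f θ) v =
      fderiv ℝ f θ v - fderiv ℝ f θ (Pi.single 2 1) * contactForm θ v := by
  conv_rhs => enter [1]; rw [eq_contactVector_add θ v, map_add, map_smul, map_contactVector]
  simp only [dContactForm, contactHamiltonian, contactVector, Matrix.cons_val, smul_eq_mul]
  ring

theorem dContactForm_contactHamiltonian_of_mem (f : J1 → ℝ) {v : J1}
    (hv : v ∈ contactDistribution θ) :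
    dContactForm (contactHamiltonian f θ) v = fderiv ℝ f θ v := by
  have : contactForm θ v = 0 := hv
  rw [dContactForm_contactHamiltonian, this, mul_zero, sub_zero]

theorem fderiv_contactHamiltonian (f : J1 → ℝ) (θ : J1) :
    fderiv ℝ f θ (contactHamiltonian f θ) = 0 := by
  rw [← dContactForm_contactHamiltonian_of_mem f (contactHamiltonian_mem f θ), dContactForm]
  ring

/-- If df vanished on the contact space it would be f_z U, a dependence. -/
theorem exists_fderiv_contactFrame_ne_zero
    (h : LinearIndependent ℝ ![contactForm θ, fderiv ℝ f θ]) :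
    ∃ j, fderiv ℝ f θ (contactFrame θ j) ≠ 0 := by
  by_contra! hz
  have hdep : fderiv ℝ f θ = fderiv ℝ f θ (Pi.single 2 1) • contactForm θ := by
    ext v
    conv_lhs => rw [eq_contactVector_add θ v, map_add, map_smul, map_contactVector]
    simp [hz, mul_comm]
  have := (LinearIndependent.pair_iff.1 h) (fderiv ℝ f θ (Pi.single 2 1)) (-1) (by
    rw [← hdep]; simp)
  simp at this

theorem contactHamiltonian_ne_zero (h : LinearIndependent ℝ ![contactForm θ, fderiv ℝ f θ]) :
    contactHamiltonian f θ ≠ 0 := by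
  intro hz
  obtain ⟨j, hj⟩ := exists_fderiv_contactFrame_ne_zero h
  have h0 := congrFun hz 0
  have h1 := congrFun hz 1
  have h3 := congrFun hz 3
  have h4 := congrFun hz 4
  simp only [contactHamiltonian, contactVector, Matrix.cons_val, Pi.zero_apply, neg_eq_zero]
    at h0 h1 h3 h4
  fin_cases j
  exacts [hj h3, hj h4, hj h0, hj h1]

theorem contDiffOn_fderiv_apply (hV : IsOpen V) (hf : ContDiffOn ℝ ∞ f V) {v : J1 → J1}
    (hv : ContDiffOn ℝ ∞ v V) : ContDiffOn ℝ ∞ (fun θ => fderiv ℝ f θ (v θ)) V :=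
  (hf.fderiv_of_isOpen hV (by simp)).clm_apply hv

theorem contDiffOn_contactHamiltonian (hV : IsOpen V) (hf : ContDiffOn ℝ ∞ f V) :
    ContDiffOn ℝ ∞ (contactHamiltonian f) V :=
  have h := fun j => contDiffOn_fderiv_apply hV hf (contDiffOn_contactFrame V j)
  contDiffOn_contactVector (h 2) (h 3) (h 0).neg (h 1).neg

end Hamiltonian

/-! ### The method of characteristics. -/

section Characteristics

variable {f : J1 → ℝ} {V : Set J1} {a : J1} {ε : ℝ} {H : ℝ × ℝ × J1 → J1}

/-- Along the characteristics of `f`, a family of curves tangent to `df = 0` remains so. -/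
theorem fderiv_eq_zero_along_characteristics (hV : IsOpen V) (hf : ContDiffOn ℝ ∞ f V)
    (hH : ContDiffOn ℝ ∞ H (Metric.ball (0, 0, a) ε))
    (hs : ∀ p ∈ Metric.ball ((0, 0, a) : ℝ × ℝ × J1) ε,
      H p ∈ V ∧ fderiv ℝ H p (1, 0, 0) = contactHamiltonian f (H p))
    (ht : ∀ p ∈ Metric.ball ((0, 0, a) : ℝ × ℝ × J1) ε,
      p.1 = 0 → fderiv ℝ f (H p) (fderiv ℝ H p (0, 1, 0)) = 0) :
    ∀ p ∈ Metric.ball ((0, 0, a) : ℝ × ℝ × J1) ε,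
      fderiv ℝ f (H p) (fderiv ℝ H p (0, 1, 0)) = 0 := by
  have hg : ContDiffOn ℝ ∞ (f ∘ H) (Metric.ball (0, 0, a) ε) := hf.comp hH fun p hp => (hs p hp).1
  have hgd : ∀ p ∈ Metric.ball ((0, 0, a) : ℝ × ℝ × J1) ε, ∀ v,
      fderiv ℝ (f ∘ H) p v = fderiv ℝ f (H p) (fderiv ℝ H p v) := fun p hp v => by
    rw [fderiv_comp p ((hf.contDiffAt (hV.mem_nhds (hs p hp).1)).differentiableAt (by simp))
      ((hH.contDiffAt (Metric.isOpen_ball.mem_nhds hp)).differentiableAt (by simp))]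
    rfl
  rintro ⟨s, t, x⟩ hp
  obtain ⟨hsε, hrest⟩ := mem_ball_triple.1 hp
  have hmem : ∀ s ∈ Set.Ioo (-ε) ε, (s, t, x) ∈ Metric.ball ((0, 0, a) : ℝ × ℝ × J1) ε :=
    fun s hs => mem_ball_triple.2 ⟨hs, hrest⟩
  rw [← hgd _ hp]
  refine eq_zero_of_linear_ode (A := fun _ => 0)
    (y := fun s => fderiv ℝ (f ∘ H) (s, t, x) (0, 1, 0)) continuousOn_const (fun r hr => ?_) ?_ s hsε
  · refine (hasDerivAt_fderiv_apply (hg.contDiffAt (Metric.isOpen_ball.mem_nhds (hmem r hr)))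
      (0, 1, 0)).congr_deriv ?_
    -- As df(X_f) = 0, f ∘ H is constant in s, that is, an integral curve of the zero field on ℝ; so
    -- ∂(f ∘ H)/∂t is constant in s too.
    rw [fderiv_fderiv_of_integralCurves (X := fun _ : ℝ => (0 : ℝ)) Metric.isOpen_ball isOpen_univ
      hg contDiffOn_const (fun p hp => ⟨trivial, ?_⟩) (hmem r hr) (0, 1, 0)]
    · simp
    · rw [hgd p hp, (hs p hp).2, fderiv_contactHamiltonian]
  · have h0 : (0 : ℝ) ∈ Set.Ioo (-ε) ε := by
      constructor <;> linarith [hsε.1.trans hsε.2]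
    change fderiv ℝ (f ∘ H) (0, t, x) (0, 1, 0) = 0
    rw [hgd _ (hmem 0 h0)]
    exact ht _ (hmem 0 h0) rfl

/-- Along the characteristics of `f`, a family of curves tangent to the contact distribution and
to `df = 0` remains so. -/
theorem contactForm_eq_zero_along_characteristics (hV : IsOpen V) (hf : ContDiffOn ℝ ∞ f V)
    (hH : ContDiffOn ℝ ∞ H (Metric.ball (0, 0, a) ε))
    (hs : ∀ p ∈ Metric.ball ((0, 0, a) : ℝ × ℝ × J1) ε,
      H p ∈ V ∧ fderiv ℝ H p (1, 0, 0) = contactHamiltonian f (H p))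
    (ht : ∀ p ∈ Metric.ball ((0, 0, a) : ℝ × ℝ × J1) ε,
      p.1 = 0 → fderiv ℝ f (H p) (fderiv ℝ H p (0, 1, 0)) = 0 ∧
        contactForm (H p) (fderiv ℝ H p (0, 1, 0)) = 0) :
    ∀ p ∈ Metric.ball ((0, 0, a) : ℝ × ℝ × J1) ε,
      contactForm (H p) (fderiv ℝ H p (0, 1, 0)) = 0 := by
  have hdf := fderiv_eq_zero_along_characteristics hV hf hH hs fun p hp h0 => (ht p hp h0).1
  have hX := contDiffOn_contactHamiltonian hV hf
  rintro ⟨s, t, x⟩ hp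
  obtain ⟨hsε, hrest⟩ := mem_ball_triple.1 hp
  have hmem : ∀ s ∈ Set.Ioo (-ε) ε, (s, t, x) ∈ Metric.ball ((0, 0, a) : ℝ × ℝ × J1) ε :=
    fun s hs => mem_ball_triple.2 ⟨hs, hrest⟩
  have hHc : ContinuousOn (fun s => H (s, t, x)) (Set.Ioo (-ε) ε) :=
    hH.continuousOn.comp (by fun_prop) hmem
  -- By Cartan's formula the Lie derivative of U along X_f is df - f_z U. Since df(∂H/∂t) = 0, the
  -- quantity U(∂H/∂t) satisfies y' = -f_z y.
  refine eq_zero_of_linear_ode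
    (A := fun s => (-fderiv ℝ f (H (s, t, x)) (Pi.single 2 1)) • ContinuousLinearMap.id ℝ ℝ)
    (y := fun s => contactForm (H (s, t, x)) (fderiv ℝ H (s, t, x) (0, 1, 0))) ?_
    (fun r hr => ?_) ?_ s hsε
  · have h1 : ContinuousOn (fun s => fderiv ℝ f (H (s, t, x)) (Pi.single 2 1))
        (Set.Ioo (-ε) ε) :=
      (contDiffOn_fderiv_apply (v := fun _ => Pi.single 2 1) hV hf
        contDiffOn_const).continuousOn.comp hHc fun s hs' => (hs _ (hmem s hs')).1
    exact h1.neg.smul (continuousOn_const (c := ContinuousLinearMap.id ℝ ℝ))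
  · have hHat := hH.contDiffAt (Metric.isOpen_ball.mem_nhds (hmem r hr))
    have hHV := hs _ (hmem r hr)
    have hH1 := (hHat.differentiableAt (by simp)).hasFDerivAt.comp_hasDerivAt r
      (hasDerivAt_triple r t x)
    have hH2 := hasDerivAt_fderiv_apply hHat (0, 1, 0)
    rw [fderiv_fderiv_of_integralCurves Metric.isOpen_ball hV hH hX hs (hmem r hr)] at hH2
    rw [hHV.2] at hH1
    have h1 := hasDerivAt_pi.1 hH1
    have h2 := hasDerivAt_pi.1 hH2
    simp only [contactForm_apply]
    refine (((h2 2).sub ((h1 3).mul (h2 0))).sub ((h1 4).mul (h2 1))).congr_deriv ?_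
    have hsec : IsLocalSection contactDistribution (H (r, t, x)) (contactHamiltonian f) :=
      ⟨V, hV, hHV.1, hX, fun η _ => contactHamiltonian_mem f η⟩
    have hdU := dContactForm_contactHamiltonian f (H (r, t, x)) (fderiv ℝ H (r, t, x) (0, 1, 0))
    rw [hdf _ (hmem r hr), dContactForm, contactForm_apply] at hdU
    rw [hsec.fderiv_apply_two]
    simp only [Function.comp_apply, _root_.smul_apply, ContinuousLinearMap.id_apply, smul_eq_mul]
    linear_combination hdU
  · have h0 : (0 : ℝ) ∈ Set.Ioo (-ε) ε := by
      constructor <;> linarith [hsε.1.trans hsε.2]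
    exact (ht _ (hmem 0 h0) rfl).2

/-- The method of characteristics: a first order equation has a solution with given tangent
plane, spanned by the characteristic direction and another vector. -/
theorem exists_solutionOfLevel (hV : IsOpen V) (hf : IsRegularFunction f V) {θ : J1} (hθ : θ ∈ V)
    {w : J1} (hw : w ∈ contactDistribution θ) (hfw : fderiv ℝ f θ w = 0)
    (hwX : ∀ c : ℝ, w ≠ c • contactHamiltonian f θ) :
    ∃ (O : Set (Fin 2 → ℝ)) (σ : (Fin 2 → ℝ) → J1), IsSolutionOfLevel f (f θ) V O σ ∧
      0 ∈ O ∧ σ 0 = θ ∧ (∃ v, fderiv ℝ σ 0 v = contactHamiltonian f θ) ∧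
        ∃ (v : Fin 2 → ℝ) (c : ℝ), c ≠ 0 ∧ fderiv ℝ σ 0 v = c • w := by
  obtain ⟨j, hj⟩ := exists_fderiv_contactFrame_ne_zero (hf.2 θ hθ)
  let e : J1 → J1 := fun η => contactFrame η j
  let u₀ : J1 → J1 := fun η => contactVector η (w 0) (w 1) (w 3) (w 4)
  have he : ContDiffOn ℝ ∞ e V := contDiffOn_contactFrame V j
  have heC : ∀ η, e η ∈ contactDistribution η := fun η => by
    change contactFrame η j ∈ _
    fin_cases j <;> exact contactVector_mem _ _ _ _ _
  have hu₀ : ContDiffOn ℝ ∞ u₀ V :=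
    contDiffOn_contactVector contDiffOn_const contDiffOn_const contDiffOn_const contDiffOn_const
  -- A field tangent to both 𝒞 and df = 0 which is a non-zero multiple of w at θ. Its integral curve
  -- through θ is the initial curve, swept out by the characteristics of f.
  let N : J1 → J1 := fun η => fderiv ℝ f η (e η) • u₀ η - fderiv ℝ f η (u₀ η) • e η
  have hN : ContDiffOn ℝ ∞ N V :=
    ((contDiffOn_fderiv_apply hV hf.1 he).smul hu₀).sub
      ((contDiffOn_fderiv_apply hV hf.1 hu₀).smul he)
  have hNC : ∀ η, contactForm η (N η) = 0 := fun η => Submodule.sub_mem _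
    (Submodule.smul_mem _ _ (contactVector_mem _ _ _ _ _)) (Submodule.smul_mem _ _ (heC η))
  have hNf : ∀ η, fderiv ℝ f η (N η) = 0 := fun η => by
    simp only [N, map_sub, map_smul, smul_eq_mul]; ring
  have hNθ : N θ = fderiv ℝ f θ (contactFrame θ j) • w := by
    have : u₀ θ = w := (eq_contactVector hw).symm
    simp only [N, this, hfw, zero_smul, sub_zero]
    rfl
  have hX := contDiffOn_contactHamiltonian hV hf.1
  obtain ⟨H, ε, hε, hH, hHp⟩ := exists_two_flows hV hθ hX hN
  have hdf := fderiv_eq_zero_along_characteristics hV hf.1 hH (fun p hp => (hHp p hp).1)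
    (fun p hp h0 => by rw [(hHp p hp).2.1 h0]; exact hNf _)
  have hU := contactForm_eq_zero_along_characteristics hV hf.1 hH (fun p hp => (hHp p hp).1)
    (fun p hp h0 => by rw [(hHp p hp).2.1 h0]; exact ⟨hNf _, hNC _⟩)
  let L : (Fin 2 → ℝ) →L[ℝ] ℝ × ℝ × J1 :=
    (ContinuousLinearMap.proj (R := ℝ) (φ := fun _ : Fin 2 => ℝ) 0).prod
      ((ContinuousLinearMap.proj (R := ℝ) (φ := fun _ : Fin 2 => ℝ) 1).prod 0)
  have hL : ∀ v, L v = (v 0, v 1, 0) := fun v => rfl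
  let l : (Fin 2 → ℝ) → ℝ × ℝ × J1 := fun u => L u + (0, 0, θ)
  have hl : ContDiff ℝ ∞ l := L.contDiff.add contDiff_const
  have hld : ∀ u, HasFDerivAt l L u := fun u => L.hasFDerivAt.add_const _
  have hl0 : l 0 = (0, 0, θ) := by simp [l]
  let S : Set (Fin 2 → ℝ) := l ⁻¹' Metric.ball (0, 0, θ) ε
  have hS : IsOpen S := Metric.isOpen_ball.preimage hl.continuous
  have h0S : (0 : Fin 2 → ℝ) ∈ S := by
    rw [Set.mem_preimage, hl0]; exact Metric.mem_ball_self hε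
  have hσ : ContDiffOn ℝ ∞ (H ∘ l) S := hH.comp hl.contDiffOn fun _ h => h
  have hσd : ∀ u ∈ S, ∀ v, fderiv ℝ (H ∘ l) u v =
      v 0 • contactHamiltonian f (H (l u)) + v 1 • fderiv ℝ H (l u) (0, 1, 0) := by
    intro u hu v
    have h := ((hH.contDiffAt (Metric.isOpen_ball.mem_nhds hu)).differentiableAt
      (by simp)).hasFDerivAt.comp u (hld u)
    have hdec : L v = v 0 • ((1, 0, 0) : ℝ × ℝ × J1) + v 1 • ((0, 1, 0) : ℝ × ℝ × J1) := by
      rw [hL]; simp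
    rw [h.fderiv, ContinuousLinearMap.comp_apply, hdec, map_add, map_smul, map_smul,
      (hHp _ hu).1.2]
  have hθmem : ((0, 0, θ) : ℝ × ℝ × J1) ∈ Metric.ball (0, 0, θ) ε := Metric.mem_ball_self hε
  have hHθ : H (0, 0, θ) = θ := ((hHp _ hθmem).2.2 rfl rfl).1
  have hσ0 : ∀ v, fderiv ℝ (H ∘ l) 0 v = v 0 • contactHamiltonian f θ +
      v 1 • fderiv ℝ f θ (contactFrame θ j) • w := by
    intro v
    rw [hσd 0 h0S, hl0, (hHp _ hθmem).2.1 rfl, hHθ, hNθ]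
  have hinj0 : Function.Injective (fderiv ℝ (H ∘ l) 0) := by
    rw [injective_iff_map_eq_zero]
    intro v hv
    rw [hσ0] at hv
    have hv1 : v 1 = 0 := by
      by_contra hne
      apply hwX (-(v 1 * fderiv ℝ f θ (contactFrame θ j))⁻¹ * v 0)
      rw [smul_smul] at hv
      rw [mul_smul, neg_smul, ← smul_neg, eq_inv_smul_iff₀ (mul_ne_zero hne hj)]
      exact eq_neg_of_add_eq_zero_right hv
    have hv0 : v 0 = 0 := by
      rw [hv1, zero_smul, add_zero] at hv
      exact (smul_eq_zero.1 hv).resolve_right (contactHamiltonian_ne_zero (hf.2 θ hθ))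
    ext k
    fin_cases k
    exacts [hv0, hv1]
  -- The immersion condition is open. The domain is then a ball, so that vanishing of d(f ∘ σ) makes
  -- f ∘ σ constant.
  have hO : IsOpen (S ∩ fderiv ℝ (H ∘ l) ⁻¹' {L | Function.Injective L}) :=
    (hσ.continuousOn_fderiv_of_isOpen hS (by simp)).isOpen_inter_preimage hS
      ContinuousLinearMap.isOpen_injective
  obtain ⟨r, hr, hball⟩ := Metric.isOpen_iff.1 hO 0 ⟨h0S, hinj0⟩
  refine ⟨Metric.ball 0 r, H ∘ l, ⟨⟨Metric.isOpen_ball, hσ.mono fun u hu => (hball hu).1,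
    fun u hu => (hHp _ (hball hu).1).1.1, fun u hu => (hball hu).2, fun u hu v => ?_⟩,
    fun u hu => ?_⟩, Metric.mem_ball_self hr, ?_, ⟨![1, 0], ?_⟩, ![0, 1],
      fderiv ℝ f θ (contactFrame θ j), hj, ?_⟩
  · rw [hσd u (hball hu).1]
    exact Submodule.add_mem _ (Submodule.smul_mem _ _ (contactHamiltonian_mem f _))
      (Submodule.smul_mem _ _ (hU _ (hball hu).1))
  · have hd : ∀ u ∈ Metric.ball (0 : Fin 2 → ℝ) r,
        HasFDerivAt (f ∘ H ∘ l) (0 : (Fin 2 → ℝ) →L[ℝ] ℝ) u := by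
      intro u hu
      have hu' := (hball hu).1
      have h1 := ((hf.1.contDiffAt (hV.mem_nhds (hHp _ hu').1.1)).differentiableAt
        (by simp)).hasFDerivAt
      have h2 := ((hσ.contDiffAt (hS.mem_nhds hu')).differentiableAt (by simp)).hasFDerivAt
      refine (HasFDerivAt.comp u (f := H ∘ l) h1 h2).congr_fderiv ?_
      ext1 v
      rw [ContinuousLinearMap.comp_apply, hσd u hu', map_add, map_smul, map_smul,
        fderiv_contactHamiltonian, hdf _ hu']
      simp
    have := (convex_ball (0 : Fin 2 → ℝ) r).is_const_of_fderivWithin_eq_zero (𝕜 := ℝ)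
      (f := f ∘ H ∘ l) (fun u hu => (hd u hu).differentiableAt.differentiableWithinAt)
      (fun u hu => by
        rw [fderivWithin_of_isOpen Metric.isOpen_ball hu]; exact (hd u hu).fderiv)
      hu (Metric.mem_ball_self hr)
    simp only [Function.comp_apply, hl0, hHθ] at this
    exact this
  · rw [Function.comp_apply, hl0, hHθ]
  · rw [hσ0]; simp
  · rw [hσ0]; simp

end Characteristics

/-! ### Intermediate integrals are the regular first integrals of the characteristic distribution.
-/

section Solutions

/-- The tangent planes of integral surfaces are isotropic. -/
theorem IsIntegralSurface.dContactForm_eq_zero {V : Set J1} {O : Set (Fin 2 → ℝ)}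
    {σ : (Fin 2 → ℝ) → J1} (h : IsIntegralSurface V O σ) {u : Fin 2 → ℝ} (hu : u ∈ O)
    (v w : Fin 2 → ℝ) : dContactForm (fderiv ℝ σ u v) (fderiv ℝ σ u w) = 0 := by
  have hσ := h.smooth.contDiffAt (h.isOpen.mem_nhds hu)
  have hσ1 := hasFDerivAt_pi'.1 (hσ.differentiableAt (by simp)).hasFDerivAt
  have hd : HasFDerivAt (fderiv ℝ σ) (fderiv ℝ (fderiv ℝ σ) u) u :=
    ((hσ.fderiv_right (m := ∞) (by simp)).differentiableAt (by simp)).hasFDerivAt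
  have hsymm : fderiv ℝ (fderiv ℝ σ) u v w = fderiv ℝ (fderiv ℝ σ) u w v :=
    (hσ.isSymmSndFDerivAt (by
      rw [minSmoothness_of_isRCLikeNormedField]; exact WithTop.coe_le_coe.2 le_top)).eq v w
  -- This is the tangency relation dz = p dx + q dy along σ, differentiated; exchanging v and w and
  -- subtracting leaves dU.
  have key : ∀ v w, fderiv ℝ (fderiv ℝ σ) u v w 2 =
      fderiv ℝ σ u v 3 * fderiv ℝ σ u w 0 + σ u 3 * fderiv ℝ (fderiv ℝ σ) u v w 0
      + (fderiv ℝ σ u v 4 * fderiv ℝ σ u w 1 + σ u 4 * fderiv ℝ (fderiv ℝ σ) u v w 1) := by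
    intro v w
    have hw : HasFDerivAt (fun u => fderiv ℝ σ u w)
        ((ContinuousLinearMap.apply ℝ J1 w).comp (fderiv ℝ (fderiv ℝ σ) u)) u :=
      (ContinuousLinearMap.apply ℝ J1 w).hasFDerivAt.comp u hd
    have hwk := hasFDerivAt_pi'.1 hw
    have h1 := ((hσ1 3).mul (hwk 0)).add ((hσ1 4).mul (hwk 1))
    have heq : (fun u => fderiv ℝ σ u w 2) =ᶠ[𝓝 u]
        fun u => σ u 3 * fderiv ℝ σ u w 0 + σ u 4 * fderiv ℝ σ u w 1 := by
      filter_upwards [h.isOpen.mem_nhds hu] with u' hu'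
      exact mem_contactDistribution.1 (h.tangent u' hu' w)
    have := congrArg (fun L => L v) ((h1.congr_of_eventuallyEq heq).unique (hwk 2))
    simp only [_root_.add_apply, _root_.smul_apply, smul_eq_mul, ContinuousLinearMap.comp_apply,
      ContinuousLinearMap.proj_apply, ContinuousLinearMap.apply_apply] at this
    linarith
  have h1 := key v w
  have h2 := key w v
  rw [hsymm] at h1
  rw [dContactForm]
  linarith

variable {ρ : TwoForm} {W V : Set J1} {f : J1 → ℝ}

/-- The hamiltonian field of a regular first integral of the characteristic distribution is
characteristic. -/
theorem IsParabolic.contactHamiltonian_mem (h : IsParabolic ρ W) (hW : IsOpen W)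
    (hρ : ContDiffOn ℝ ∞ ρ W) {θ : J1} (hθ : θ ∈ W)
    (hD : ∀ v ∈ characteristicDistribution ρ θ, fderiv ℝ f θ v = 0) :
    contactHamiltonian f θ ∈ characteristicDistribution ρ θ :=
  h.mem_of_orthogonal hW hρ hθ (_root_.contactHamiltonian_mem f θ) fun d hd => by
    rw [dContactForm_contactHamiltonian_of_mem f (h.le_contactDistribution hθ hd), hD d hd]

/-- Regular first integrals of the characteristic distribution are intermediate integrals. -/
theorem IsParabolic.isIntermediateIntegral (h : IsParabolic ρ W) (hW : IsOpen W)
    (hρ : ContDiffOn ℝ ∞ ρ W) (hV : IsOpen V) (hVW : V ⊆ W) (hf : IsRegularFunction f V)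
    (hD : ∀ θ ∈ V, ∀ v ∈ characteristicDistribution ρ θ, fderiv ℝ f θ v = 0) :
    IsIntermediateIntegral ρ V f := by
  refine ⟨hf, fun k O σ ⟨hσ, hk⟩ => ⟨hσ, fun u hu => ?_⟩⟩
  have hθV := hσ.mapsTo u hu
  have hθ := hVW hθV
  have hfσ : ∀ v, fderiv ℝ f (σ u) (fderiv ℝ σ u v) = 0 := by
    intro v
    have h1 := ((hf.1.contDiffAt (hV.mem_nhds hθV)).differentiableAt (by simp)).hasFDerivAt
    have h2 := ((hσ.smooth.contDiffAt (hσ.isOpen.mem_nhds hu)).differentiableAt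
      (by simp)).hasFDerivAt
    have heq : f ∘ σ =ᶠ[𝓝 u] fun _ => k := by
      filter_upwards [hσ.isOpen.mem_nhds hu] with u' hu' using hk u' hu'
    exact congrArg (fun L => L v) ((h1.comp u h2).unique
      ((hasFDerivAt_const k u).congr_of_eventuallyEq heq))
  have hXD := h.contactHamiltonian_mem hW hρ hθ (hD _ hθV)
  -- The tangent plane is Lagrangian and df vanishes on it, so it contains its skew-orthogonal
  -- vector X_f.
  have hXT : contactHamiltonian f (σ u) ∈
      LinearMap.range (fderiv ℝ σ u : (Fin 2 → ℝ) →ₗ[ℝ] J1) := by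
    refine mem_of_isotropic (θ := σ u) ?_ ?_ ?_ (_root_.contactHamiltonian_mem f _) ?_
    · rintro _ ⟨v, rfl⟩
      exact hσ.tangent u hu v
    · rintro _ ⟨v, rfl⟩ _ ⟨w, rfl⟩
      exact hσ.dContactForm_eq_zero hu v w
    · rw [LinearMap.finrank_range_of_inj (hσ.immersion u hu)]; simp
    · rintro _ ⟨v, rfl⟩
      exact (dContactForm_contactHamiltonian_of_mem f (hσ.tangent u hu v)).trans (hfσ v)
  obtain ⟨a, ha⟩ := hXT
  change fderiv ℝ σ u a = _ at ha
  have ha0 : a ≠ 0 := by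
    rintro rfl
    rw [map_zero] at ha
    exact contactHamiltonian_ne_zero (hf.2 _ hθV) ha.symm
  let B := alternatingBilin (ρ (σ u))
  -- As X_f is in the radical, ρ(X_f, ·) = -c dU(X_f, ·) = -c df, which is zero on the tangent
  -- plane. A skew form on a plane with a non-zero radical vector vanishes.
  have hXB : ∀ w, B (fderiv ℝ σ u a) (fderiv ℝ σ u w) = 0 := by
    intro w
    rw [h.characteristicDistribution_eq hθ] at hXD
    have := hXD.2 _ (hσ.tangent u hu w)
    rw [dContactForm_contactHamiltonian_of_mem f (hσ.tangent u hu w), hfσ, mul_zero, add_zero,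
      ← ha] at this
    exact this
  have hdec : ∀ v : Fin 2 → ℝ, v = v 0 • ![1, 0] + v 1 • ![0, 1] := fun v => by
    ext k; fin_cases k <;> simp
  have hBdet : ∀ v w, B (fderiv ℝ σ u v) (fderiv ℝ σ u w) =
      (v 0 * w 1 - v 1 * w 0) * B (fderiv ℝ σ u ![1, 0]) (fderiv ℝ σ u ![0, 1]) := by
    intro v w
    conv_lhs => rw [hdec v, hdec w]
    simp only [map_add, map_smul, LinearMap.add_apply, LinearMap.smul_apply, smul_eq_mul]
    have h1 : B (fderiv ℝ σ u ![0, 1]) (fderiv ℝ σ u ![1, 0]) =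
      -B (fderiv ℝ σ u ![1, 0]) (fderiv ℝ σ u ![0, 1]) := alternatingBilin_swap _ _ _
    have h2 : ∀ x, B x x = 0 := alternatingBilin_self _
    rw [h1, h2, h2]
    ring
  have hB0 : B (fderiv ℝ σ u ![1, 0]) (fderiv ℝ σ u ![0, 1]) = 0 := by
    by_contra hne
    have h0 := hXB ![0, 1]
    have h1 := hXB ![1, 0]
    rw [hBdet] at h0 h1
    simp [hne] at h0 h1
    apply ha0
    ext k
    fin_cases k
    exacts [h0, h1]
  intro v w
  change B _ _ = 0
  rw [hBdet, hB0, mul_zero]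

/-- Intermediate integrals are first integrals of the characteristic distribution. -/
theorem IsIntermediateIntegral.fderiv_eq_zero (hpar : IsParabolic ρ W) (hV : IsOpen V)
    (hVW : V ⊆ W) (hf : IsIntermediateIntegral ρ V f) {θ : J1} (hθ : θ ∈ V) :
    ∀ v ∈ characteristicDistribution ρ θ, fderiv ℝ f θ v = 0 := by
  let B := alternatingBilin (ρ θ)
  have hB : ∀ w ∈ contactDistribution θ, fderiv ℝ f θ w = 0 →
      B (contactHamiltonian f θ) w = 0 := by
    intro w hw hfw
    by_cases hc : ∃ c : ℝ, w = c • contactHamiltonian f θ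
    · obtain ⟨c, rfl⟩ := hc
      rw [map_smul, alternatingBilin_self, smul_zero]
    · obtain ⟨O, σ, hσ, h0, hσ0, ⟨v, hv⟩, v', c, hc, hv'⟩ :=
        exists_solutionOfLevel hV hf.1 hθ hw hfw (not_exists.1 hc)
      have := (hf.2 _ O σ hσ).2 0 h0 v v'
      rw [hv, hv', hσ0] at this
      change B (contactHamiltonian f θ) (c • w) = 0 at this
      rw [map_smul, smul_eq_mul] at this
      exact (mul_eq_zero.1 this).resolve_left hc
  obtain ⟨j, hj⟩ := exists_fderiv_contactFrame_ne_zero (hf.1.2 θ hθ)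
  have he : contactFrame θ j ∈ contactDistribution θ := by
    fin_cases j <;> exact contactVector_mem _ _ _ _ _
  -- By `hB`, ρ(X_f, ·) is proportional to df = dU(X_f, ·) on 𝒞; evaluating on a frame vector not
  -- killed by df gives the value of c.
  have hrad : contactHamiltonian f θ ∈ radicalOnContact ρ
      (-(B (contactHamiltonian f θ) (contactFrame θ j) / fderiv ℝ f θ (contactFrame θ j))) θ := by
    refine ⟨contactHamiltonian_mem f θ, fun w hw => ?_⟩
    rw [dContactForm_contactHamiltonian_of_mem f hw]
    have h1 := hB (w - (fderiv ℝ f θ w / fderiv ℝ f θ (contactFrame θ j)) • contactFrame θ j)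
      (Submodule.sub_mem _ hw (Submodule.smul_mem _ _ he)) (by
        rw [map_sub, map_smul, smul_eq_mul, div_mul_cancel₀ _ hj, sub_self])
    rw [map_sub, map_smul, smul_eq_mul] at h1
    change B (contactHamiltonian f θ) w + _ = 0
    rw [← h1]
    ring
  have hXD := radicalOnContact_le_characteristicDistribution ρ _ _ hrad
  intro v hv
  rw [← dContactForm_contactHamiltonian_of_mem f (hpar.le_contactDistribution (hVW hθ) hv)]
  exact hpar.isotropic (hVW hθ) _ hXD _ hv

end Solutions

/-! ### Frobenius, the rank dichotomy and the two cases. -/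

section Main

variable {ρ : TwoForm} {W V : Set J1} {f : J1 → ℝ}

/-- Frobenius' theorem for the characteristic distribution. -/
theorem IsParabolic.isIntegrableOn (h : IsParabolic ρ W) (hW : IsOpen W)
    (hρ : ContDiffOn ℝ ∞ ρ W) (hinv : ∀ θ ∈ W,
      derivedDistribution (characteristicDistribution ρ) θ = characteristicDistribution ρ θ) :
    IsIntegrableOn (characteristicDistribution ρ) W := by
  intro a ha
  obtain ⟨i, j, V, X, Y, hij, hV, haV, hVW, hX, hY, hXY⟩ := h.exists_frame hW hρ ha
  have hcoord : ∀ {Z : J1 → J1} {k : Fin 5} {c : ℝ} {η : J1}, ContDiffOn ℝ ∞ Z V → η ∈ V →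
      (∀ η ∈ V, Z η k = c) → ∀ v, fderiv ℝ Z η v k = 0 := by
    intro Z k c η hZ hη hc v
    have h1 := hasFDerivAt_pi'.1
      ((hZ.contDiffAt (hV.mem_nhds hη)).differentiableAt (by simp)).hasFDerivAt k
    have heq : (fun η => Z η k) =ᶠ[𝓝 η] fun _ => c := by
      filter_upwards [hV.mem_nhds hη] with η' hη' using hc η' hη'
    exact congrArg (fun L => L v)
      (h1.unique ((hasFDerivAt_const c η).congr_of_eventuallyEq heq))
  have hdec : ∀ η ∈ V, ∀ v ∈ characteristicDistribution ρ η, v = v i • X η + v j • Y η := by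
    intro η hη v hv
    obtain ⟨⟨h1, h2⟩, h3, h4, h5, h6⟩ := hXY η hη
    exact eq_smul_add_smul_of_finrank_le_two
      (h.finrank_characteristicDistribution hW hρ (hVW hη)).le h1 h2 h3 h4 h5 h6 hv
  -- The i-th and j-th components of X and Y are constant, so those of the bracket vanish; a vector
  -- of 𝒟 is determined by these two components.
  have hbr : ∀ η ∈ V, VectorField.lieBracket ℝ X Y η = 0 := by
    intro η hη
    have hmem : VectorField.lieBracket ℝ X Y η ∈ characteristicDistribution ρ η := by
      rw [← hinv η (hVW hη)]
      exact lieBracket_mem_derivedDistribution ⟨V, hV, hη, hX, fun η hη => (hXY η hη).1.1⟩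
        ⟨V, hV, hη, hY, fun η hη => (hXY η hη).1.2⟩
    have hi : VectorField.lieBracket ℝ X Y η i = 0 := by
      change fderiv ℝ Y η (X η) i - fderiv ℝ X η (Y η) i = 0
      rw [hcoord hY hη fun η hη => (hXY η hη).2.2.2.1, hcoord hX hη fun η hη => (hXY η hη).2.1,
        sub_zero]
    have hj : VectorField.lieBracket ℝ X Y η j = 0 := by
      change fderiv ℝ Y η (X η) j - fderiv ℝ X η (Y η) j = 0
      rw [hcoord hY hη fun η hη => (hXY η hη).2.2.2.2, hcoord hX hη fun η hη => (hXY η hη).2.2.1,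
        sub_zero]
    rw [hdec η hη _ hmem, hi, hj, zero_smul, zero_smul, add_zero]
  obtain ⟨-, h3, h4, h5, h6⟩ := hXY a haV
  obtain ⟨O, F, hO, haO, hOV, hF, hFs⟩ :=
    exists_first_integrals_of_commuting hV haV hX hY hij h3 h4 h5 h6 hbr
  refine ⟨O, hO, haO, hOV.trans hVW, 3, F, hF, fun θ hθ => ?_⟩
  obtain ⟨hs, hFX, hFY⟩ := hFs θ hθ
  refine ⟨hs, Submodule.eq_of_le_of_finrank_eq (fun v hv => ?_) ?_⟩
  · change fderiv ℝ F θ v = 0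
    rw [hdec θ (hOV hθ) v hv, map_add, map_smul, map_smul, hFX, hFY, smul_zero, smul_zero,
      add_zero]
  · rw [h.finrank_characteristicDistribution hW hρ (hVW (hOV hθ))]
    have h1 := LinearMap.finrank_range_add_finrank_ker (fderiv ℝ F θ : J1 →ₗ[ℝ] (Fin 3 → ℝ))
    rw [LinearMap.range_eq_top.2 hs, finrank_top, Module.finrank_fin_fun,
      Module.finrank_fin_fun] at h1
    omega

/-- U([X, Y]) = -dU(X, Y), and 𝒟 is isotropic. -/
theorem IsParabolic.derivedDistribution_le_contact (h : IsParabolic ρ W) (hW : IsOpen W)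
    {θ : J1} (hθ : θ ∈ W) :
    derivedDistribution (characteristicDistribution ρ) θ ≤ contactDistribution θ := by
  refine derivedDistribution_le (h.le_contactDistribution hθ) fun X Y hX hY => ?_
  have hle := fun η hη => h.le_contactDistribution (θ := η) hη
  change contactForm θ _ = 0
  rw [contactForm_lieBracket (hX.congr hW hθ hle) (hY.congr hW hθ hle),
    h.isotropic hθ _ hX.eventually_mem.self_of_nhds _ hY.eventually_mem.self_of_nhds, neg_zero]

/-- If the second derived distribution is contained in the contact distribution at a point, then
the characteristic distribution equals its first derived distribution there. -/
theorem IsParabolic.derivedDistribution_le_of_contact (h : IsParabolic ρ W) (hW : IsOpen W)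
    (hρ : ContDiffOn ℝ ∞ ρ W) {θ : J1} (hθ : θ ∈ W)
    (hle : derivedDistribution (derivedDistribution (characteristicDistribution ρ)) θ ≤
      contactDistribution θ) :
    derivedDistribution (characteristicDistribution ρ) θ ≤ characteristicDistribution ρ θ := by
  have hsec := exists_localSection_derivedDistribution fun v hv => h.exists_localSection hW hρ hθ hv
  intro v hv
  -- 𝒟 is Lagrangian, so it is enough that dU(v, w) = 0 for w in 𝒟. Extending v and w to sections of
  -- 𝒟' ⊂ 𝒞, dU(v, w) is -U of their bracket, which lies in 𝒟''.
  refine h.mem_of_orthogonal hW hρ hθ (h.derivedDistribution_le_contact hW hθ hv) fun w hw => ?_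
  obtain ⟨X, hX, rfl⟩ := hsec v hv
  obtain ⟨Y, hY, rfl⟩ := hsec w (le_derivedDistribution _ _ hw)
  have hC := fun η hη => h.derivedDistribution_le_contact hW (θ := η) hη
  have h1 := contactForm_lieBracket (hX.congr hW hθ hC) (hY.congr hW hθ hC)
  have h2 : contactForm θ (VectorField.lieBracket ℝ X Y θ) = 0 :=
    hle (lieBracket_mem_derivedDistribution hX hY)
  linarith

theorem IsIntermediateIntegral.fderiv_derivedDistribution (hpar : IsParabolic ρ W)
    (hV : IsOpen V) (hVW : V ⊆ W) (hf : IsIntermediateIntegral ρ V f) {θ : J1} (hθ : θ ∈ V) :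
    derivedDistribution (characteristicDistribution ρ) θ ≤
      LinearMap.ker (fderiv ℝ f θ : J1 →ₗ[ℝ] ℝ) :=
  fderiv_eq_zero_of_mem_derivedDistribution hV hθ hf.1.1
    fun _ hη => hf.fderiv_eq_zero hpar hV hVW hη

theorem IsIntermediateIntegral.fderiv_derivedDistribution₂ (hpar : IsParabolic ρ W)
    (hV : IsOpen V) (hVW : V ⊆ W) (hf : IsIntermediateIntegral ρ V f) {θ : J1} (hθ : θ ∈ V) :
    derivedDistribution (derivedDistribution (characteristicDistribution ρ)) θ ≤
      LinearMap.ker (fderiv ℝ f θ : J1 →ₗ[ℝ] ℝ) :=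
  fderiv_eq_zero_of_mem_derivedDistribution hV hθ hf.1.1
    fun _ hη => hf.fderiv_derivedDistribution hpar hV hVW hη

/-- If the characteristic distribution is not its own derived distribution, then the second
derived distribution is defined by any intermediate integral. -/
theorem IsIntermediateIntegral.derivedDistribution₂_eq (hpar : IsParabolic ρ W)
    (hW : IsOpen W) (hρ : ContDiffOn ℝ ∞ ρ W) (hV : IsOpen V) (hVW : V ⊆ W)
    (hf : IsIntermediateIntegral ρ V f) {θ : J1} (hθ : θ ∈ V)
    (h3 : 3 ≤ Module.finrank ℝ (derivedDistribution (characteristicDistribution ρ) θ)) :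
    derivedDistribution (derivedDistribution (characteristicDistribution ρ)) θ =
      LinearMap.ker (fderiv ℝ f θ : J1 →ₗ[ℝ] ℝ) ∧ Module.finrank ℝ
        (derivedDistribution (derivedDistribution (characteristicDistribution ρ)) θ) = 4 := by
  have hle := hf.fderiv_derivedDistribution₂ hpar hV hVW hθ
  have hlt : derivedDistribution (characteristicDistribution ρ) θ <
      derivedDistribution (derivedDistribution (characteristicDistribution ρ)) θ := by
    refine lt_of_le_of_ne (le_derivedDistribution _ _) fun heq => ?_
    have h1 := hpar.derivedDistribution_le_of_contact hW hρ (hVW hθ)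
      (heq ▸ hpar.derivedDistribution_le_contact hW (hVW hθ))
    have h2 := Submodule.finrank_mono h1
    rw [hpar.finrank_characteristicDistribution hW hρ (hVW hθ)] at h2
    omega
  have hker : LinearMap.ker (fderiv ℝ f θ : J1 →ₗ[ℝ] ℝ) < ⊤ := by
    obtain ⟨j, hj⟩ := exists_fderiv_contactFrame_ne_zero (hf.1.2 θ hθ)
    exact lt_top_iff_ne_top.2 fun heq => hj (heq ▸ Submodule.mem_top : contactFrame θ j ∈
      LinearMap.ker (fderiv ℝ f θ : J1 →ₗ[ℝ] ℝ))
  -- The dimensions satisfy 3 ≤ dim 𝒟' < dim 𝒟'' ≤ dim ker df < 5, which forces dim 𝒟'' = dim ker df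
  -- = 4.
  have h4 := Submodule.finrank_lt_finrank_of_lt hlt
  have h5 := Submodule.finrank_lt_finrank_of_lt hker
  have h6 := Submodule.finrank_mono hle
  rw [finrank_top, Module.finrank_fin_fun] at h5
  exact ⟨Submodule.eq_of_le_of_finrank_eq hle (by omega), by omega⟩

theorem fderiv_eq_zero_of_isLocallyFunctionOf {G : Type} [NormedAddCommGroup G] [NormedSpace ℝ G]
    {g : J1 → ℝ} {F : J1 → G} (hg : IsLocallyFunctionOf g F V) {θ : J1} (hθ : θ ∈ V)
    (hF : DifferentiableAt ℝ F θ) {v : J1} (hv : fderiv ℝ F θ v = 0) : fderiv ℝ g θ v = 0 := by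
  obtain ⟨φ, hφ, heq⟩ := hg θ hθ
  have h1 : HasFDerivAt (fun x => φ (F x)) _ θ :=
    ((hφ.differentiable (by simp)) (F θ)).hasFDerivAt.comp θ hF.hasFDerivAt
  rw [(h1.congr_of_eventuallyEq heq).fderiv, ContinuousLinearMap.comp_apply, hv, map_zero]

/-- A non-zero functional vanishing on the range would be a linear relation between the components.
-/
theorem surjective_of_linearIndependent_components {n : ℕ} {L : J1 →L[ℝ] (Fin n → ℝ)}
    (h : LinearIndependent ℝ fun i =>
      (ContinuousLinearMap.proj (R := ℝ) (φ := fun _ : Fin n => ℝ) i).comp L) :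
    Function.Surjective L := by
  rw [← ContinuousLinearMap.coe_coe, ← LinearMap.range_eq_top]
  by_contra hne
  obtain ⟨g, hg0, hg⟩ := Submodule.exists_le_ker_of_lt_top _ (lt_top_iff_ne_top.2 hne)
  apply hg0
  have hdec : ∀ y : Fin n → ℝ, g y = ∑ i, g (Pi.single i 1) * y i := fun y => by
    conv_lhs => rw [← Finset.univ_sum_single y]
    rw [map_sum]
    refine Finset.sum_congr rfl fun i _ => ?_
    rw [← mul_one (y i), ← smul_eq_mul, Pi.single_smul, map_smul]
    simp [mul_comm]
  have hz := Fintype.linearIndependent_iff.1 h (fun i => g (Pi.single i 1)) (by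
    ext v
    have := hg ⟨v, rfl⟩
    rw [LinearMap.mem_ker, hdec] at this
    simpa using this)
  ext1 y
  ext
  simp [hz]

theorem linearIndependent_components_of_surjective {n : ℕ} {L : J1 →L[ℝ] (Fin n → ℝ)}
    (h : Function.Surjective L) : LinearIndependent ℝ fun i =>
      (ContinuousLinearMap.proj (R := ℝ) (φ := fun _ : Fin n => ℝ) i).comp L := by
  rw [Fintype.linearIndependent_iff]
  intro c hc i
  obtain ⟨v, hv⟩ := h (Pi.single i 1)
  have := congrArg (fun M => M v) hc
  simpa [hv, Pi.single_apply] using this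

theorem fderiv_component {n : ℕ} {F : J1 → Fin n → ℝ} {θ : J1} (hF : DifferentiableAt ℝ F θ)
    (i : Fin n) : fderiv ℝ (fun η => F η i) θ =
      (ContinuousLinearMap.proj (R := ℝ) (φ := fun _ : Fin n => ℝ) i).comp (fderiv ℝ F θ) :=
  (hasFDerivAt_pi'.1 hF.hasFDerivAt i).fderiv

/-- An integrable characteristic distribution has three independent first integrals. -/
theorem IsParabolic.exists_areIndependentFirstIntegrals (h : IsParabolic ρ W) (hW : IsOpen W)
    (hρ : ContDiffOn ℝ ∞ ρ W) (hint : IsIntegrableOn (characteristicDistribution ρ) W) :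
    ∀ a ∈ W, ∃ V : Set J1, IsOpen V ∧ a ∈ V ∧ V ⊆ W ∧
      ∃ F, AreIndependentFirstIntegrals (characteristicDistribution ρ) V F := by
  intro a ha
  obtain ⟨V, hV, haV, hVW, n, F, hF, hFs⟩ := hint a ha
  have hn : n = 3 := by
    have h1 := LinearMap.finrank_range_add_finrank_ker (fderiv ℝ F a : J1 →ₗ[ℝ] (Fin n → ℝ))
    rw [LinearMap.range_eq_top.2 (hFs a haV).1, finrank_top, Module.finrank_fin_fun,
      Module.finrank_fin_fun, ← (hFs a haV).2,
      h.finrank_characteristicDistribution hW hρ ha] at h1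
    omega
  subst hn
  have hd : ∀ θ ∈ V, DifferentiableAt ℝ F θ := fun θ hθ =>
    (hF.contDiffAt (hV.mem_nhds hθ)).differentiableAt (by simp)
  refine ⟨V, hV, haV, hVW, F, contDiffOn_pi.1 hF, fun i θ hθ v hv => ?_, fun θ hθ => ?_⟩
  · rw [fderiv_component (hd θ hθ), ContinuousLinearMap.comp_apply]
    rw [(hFs θ hθ).2] at hv
    have : fderiv ℝ F θ v = 0 := hv
    rw [this, map_zero]
  · simp only [fderiv_component (hd θ hθ)]
    exact linearIndependent_components_of_surjective (hFs θ hθ).1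

theorem IsParabolic.isIntermediateIntegral_iff (h : IsParabolic ρ W) (hW : IsOpen W)
    (hρ : ContDiffOn ℝ ∞ ρ W) (hV : IsOpen V) (hVW : V ⊆ W) :
    IsIntermediateIntegral ρ V f ↔ IsRegularFunction f V ∧
      ∀ θ ∈ V, ∀ v ∈ characteristicDistribution ρ θ, fderiv ℝ f θ v = 0 :=
  ⟨fun hf => ⟨hf.1, fun _ hθ => hf.fderiv_eq_zero h hV hVW hθ⟩,
    fun hf => h.isIntermediateIntegral hW hρ hV hVW hf.1 hf.2⟩

/-- The intermediate integrals are the functions of three independent first integrals. -/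
theorem IsParabolic.isIntermediateIntegral_iff_of_firstIntegrals (h : IsParabolic ρ W)
    (hW : IsOpen W) (hρ : ContDiffOn ℝ ∞ ρ W) (hV : IsOpen V) (hVW : V ⊆ W)
    {F : J1 → Fin 3 → ℝ} (hF : AreIndependentFirstIntegrals (characteristicDistribution ρ) V F) :
    IsIntermediateIntegral ρ V f ↔ IsRegularFunction f V ∧ IsLocallyFunctionOf f F V := by
  have hFs : ContDiffOn ℝ ∞ F V := contDiffOn_pi.2 hF.1
  have hd : ∀ θ ∈ V, DifferentiableAt ℝ F θ := fun θ hθ =>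
    (hFs.contDiffAt (hV.mem_nhds hθ)).differentiableAt (by simp)
  have hFD : ∀ θ ∈ V, ∀ v ∈ characteristicDistribution ρ θ, fderiv ℝ F θ v = 0 := by
    intro θ hθ v hv
    ext i
    have := hF.2.1 i θ hθ v hv
    rwa [fderiv_component (hd θ hθ)] at this
  have hsurj : ∀ θ ∈ V, Function.Surjective (fderiv ℝ F θ) := by
    intro θ hθ
    have := hF.2.2 θ hθ
    simp only [fderiv_component (hd θ hθ)] at this
    exact surjective_of_linearIndependent_components this
  have hker : ∀ θ ∈ V, ∀ v, fderiv ℝ F θ v = 0 → v ∈ characteristicDistribution ρ θ := by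
    intro θ hθ v hv
    have h1 := LinearMap.finrank_range_add_finrank_ker (fderiv ℝ F θ : J1 →ₗ[ℝ] (Fin 3 → ℝ))
    rw [LinearMap.range_eq_top.2 (hsurj θ hθ), finrank_top, Module.finrank_fin_fun,
      Module.finrank_fin_fun] at h1
    have heq : characteristicDistribution ρ θ =
        LinearMap.ker (fderiv ℝ F θ : J1 →ₗ[ℝ] (Fin 3 → ℝ)) :=
      Submodule.eq_of_le_of_finrank_eq (hFD θ hθ) (by
        rw [h.finrank_characteristicDistribution hW hρ (hVW hθ)]; omega)
    rw [heq]
    exact hv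
  rw [h.isIntermediateIntegral_iff hW hρ hV hVW]
  refine and_congr_right fun hf => ⟨fun hfD a ha => ?_, fun hloc θ hθ v hv => ?_⟩
  · exact exists_eq_comp_of_ker_fderiv_le hV ha hFs hf.1 (hsurj a ha)
      fun θ hθ v hv => hfD θ hθ v (hker θ hθ v hv)
  · exact fderiv_eq_zero_of_isLocallyFunctionOf hloc hθ (hd θ hθ) (hFD θ hθ v hv)

theorem continuous_contactForm : Continuous contactForm := by
  unfold contactForm
  fun_prop

/-- An equation with integrable characteristic distribution admits intermediate integrals. -/
theorem IsParabolic.admits_of_isIntegrableOn (h : IsParabolic ρ W) (hW : IsOpen W)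
    (hρ : ContDiffOn ℝ ∞ ρ W) (hint : IsIntegrableOn (characteristicDistribution ρ) W) :
    AdmitsIntermediateIntegrals ρ W := by
  intro a ha
  obtain ⟨V, hV, haV, hVW, F, hFs, hFD, hFi⟩ :=
    h.exists_areIndependentFirstIntegrals hW hρ hint a ha
  have hU0 : contactForm a ≠ 0 := fun h0 => single_two_notMem_contact a (by
    change contactForm a _ = 0
    rw [h0]; rfl)
  obtain ⟨i, hi⟩ : ∃ i, LinearIndependent ℝ ![contactForm a, fderiv ℝ (fun η => F η i) a] := by
    by_contra! hdep
    have hc : ∀ i, ∃ c : ℝ, c • contactForm a = fderiv ℝ (fun η => F η i) a := fun i => by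
      have := hdep i
      rw [LinearIndependent.pair_iff' hU0] at this
      simpa using this
    choose c hc using hc
    -- If dF_i = c_i U for all i, then c₁ dF₀ - c₀ dF₁ = 0; independence gives c₀ = 0, hence dF₀ =
    -- 0.
    have hz := Fintype.linearIndependent_iff.1 (hFi a haV) ![c 1, -c 0, 0] (by
      simp only [Fin.sum_univ_three, ← hc, smul_smul, ← add_smul, Matrix.cons_val]
      rw [show c 1 * c 0 + -c 0 * c 1 + 0 * c 2 = 0 by ring, zero_smul]) 1
    simp only [Matrix.cons_val, neg_eq_zero] at hz
    apply (hFi a haV).ne_zero 0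
    rw [← hc, hz, zero_smul]
  let A : J1 → Fin 2 → (J1 →L[ℝ] ℝ) := fun θ =>
    ![contactForm θ, fderiv ℝ (fun η => F η i) θ]
  have hA : ContinuousOn A V := by
    refine continuousOn_pi.2 fun k => ?_
    fin_cases k
    · exact continuous_contactForm.continuousOn
    · exact (hFs i).continuousOn_fderiv_of_isOpen hV (by simp)
  have hopen : IsOpen (V ∩ A ⁻¹' {v | LinearIndependent ℝ v}) :=
    hA.isOpen_inter_preimage hV isOpen_setOfPred_linearIndependent
  have hsub : V ∩ A ⁻¹' {v | LinearIndependent ℝ v} ⊆ V := Set.inter_subset_left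
  refine ⟨_, hopen, ⟨haV, hi⟩, hsub.trans hVW, fun η => F η i, ?_⟩
  exact h.isIntermediateIntegral hW hρ hopen (hsub.trans hVW)
    ⟨(hFs i).mono hsub, fun θ hθ => hθ.2⟩ fun θ hθ => hFD i θ hθ.1

/-- If the second derived distribution has rank four, it is not contact. -/
theorem IsParabolic.not_derivedDistribution₂_le_contact (h : IsParabolic ρ W) (hW : IsOpen W)
    (hρ : ContDiffOn ℝ ∞ ρ W) {m : ℕ} (hrank : ∀ θ ∈ W,
      Module.finrank ℝ (derivedDistribution (characteristicDistribution ρ) θ) = m)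
    {θ : J1} (hθ : θ ∈ W) (h4 : Module.finrank ℝ
      (derivedDistribution (derivedDistribution (characteristicDistribution ρ)) θ) = 4) :
    ¬ derivedDistribution (derivedDistribution (characteristicDistribution ρ)) θ ≤
      contactDistribution θ := by
  intro hle
  have hfin := fun η hη => h.finrank_characteristicDistribution hW hρ (θ := η) hη
  have h1 := Submodule.finrank_mono (h.derivedDistribution_le_of_contact hW hρ hθ hle)
  rw [hrank θ hθ, hfin θ hθ] at h1
  -- Constancy of the rank spreads 𝒟' = 𝒟 from θ to all of W. Then 𝒟'' = 𝒟 has dimension 2, not 4.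
  have heq : ∀ η ∈ W, derivedDistribution (characteristicDistribution ρ) η =
      characteristicDistribution ρ η := fun η hη =>
    (Submodule.eq_of_le_of_finrank_le (le_derivedDistribution _ _)
      (by rw [hrank η hη, hfin η hη]; exact h1)).symm
  rw [derivedDistribution_congr hW hθ heq, heq θ hθ, hfin θ hθ] at h4
  omega

theorem IsFourDimIntegrableOn.exists_isKernelOfDifferential {P : TangentField}
    (h : IsFourDimIntegrableOn P W) : ∀ a ∈ W, ∃ V : Set J1, IsOpen V ∧ a ∈ V ∧ V ⊆ W ∧
      ∃ f, IsKernelOfDifferential P V f := by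
  intro a ha
  obtain ⟨V, hV, haV, hVW, n, F, hF, hFs⟩ := h.2 a ha
  have hn : n = 1 := by
    have h1 := LinearMap.finrank_range_add_finrank_ker (fderiv ℝ F a : J1 →ₗ[ℝ] (Fin n → ℝ))
    rw [LinearMap.range_eq_top.2 (hFs a haV).1, finrank_top, Module.finrank_fin_fun,
      Module.finrank_fin_fun, ← (hFs a haV).2, h.1 a ha] at h1
    omega
  subst hn
  refine ⟨V, hV, haV, hVW, fun θ => F θ 0, contDiffOn_pi.1 hF 0, fun θ hθ => ?_⟩
  rw [(hFs θ hθ).2, fderiv_component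
    ((hF.contDiffAt (hV.mem_nhds hθ)).differentiableAt (by simp))]
  ext v
  change fderiv ℝ F θ v = 0 ↔ fderiv ℝ F θ v 0 = 0
  exact ⟨fun h => by rw [h]; rfl, fun h => by ext k; fin_cases k; exact h⟩

theorem surjective_fderiv_of_isKernelOfDifferential {P : TangentField}
    (hP : ∀ θ ∈ V, Module.finrank ℝ (P θ) = 4) (hf : IsKernelOfDifferential P V f) {θ : J1}
    (hθ : θ ∈ V) : Function.Surjective (fderiv ℝ f θ) := by
  refine LinearMap.surjective (f := (fderiv ℝ f θ : J1 →ₗ[ℝ] ℝ)) fun h0 => ?_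
  have h1 := hP θ hθ
  rw [hf.2 θ hθ, h0, LinearMap.ker_zero, finrank_top, Module.finrank_fin_fun] at h1
  omega

/-- A function whose differential defines the second derived distribution is an intermediate
integral. -/
theorem IsParabolic.isIntermediateIntegral_of_isKernelOfDifferential (h : IsParabolic ρ W)
    (hW : IsOpen W) (hρ : ContDiffOn ℝ ∞ ρ W) {m : ℕ} (hrank : ∀ θ ∈ W,
      Module.finrank ℝ (derivedDistribution (characteristicDistribution ρ) θ) = m)
    (h4 : ∀ θ ∈ W, Module.finrank ℝ
      (derivedDistribution (derivedDistribution (characteristicDistribution ρ)) θ) = 4)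
    (hV : IsOpen V) (hVW : V ⊆ W) (hf : IsKernelOfDifferential
      (derivedDistribution (derivedDistribution (characteristicDistribution ρ))) V f) :
    IsIntermediateIntegral ρ V f := by
  refine h.isIntermediateIntegral hW hρ hV hVW ⟨hf.1, fun θ hθ => ?_⟩ fun θ hθ v hv => ?_
  · have hnot := h.not_derivedDistribution₂_le_contact hW hρ hrank (hVW hθ) (h4 θ (hVW hθ))
    -- A vector x with df(x) = 0 and U(x) ≠ 0, together with y where df(y) = 1, separates U from df.
    obtain ⟨x, hx, hxC⟩ := SetLike.not_le_iff_exists.1 hnot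
    rw [hf.2 θ hθ] at hx
    obtain ⟨y, hy⟩ := surjective_fderiv_of_isKernelOfDifferential
      (fun θ hθ => h4 θ (hVW hθ)) hf hθ 1
    refine LinearIndependent.pair_iff.2 fun s t hst => ?_
    have hx0 : fderiv ℝ f θ x = 0 := hx
    have h1 := congrArg (fun L => L x) hst
    simp only [_root_.add_apply, _root_.smul_apply, hx0, smul_eq_mul, mul_zero, add_zero,
      _root_.zero_apply] at h1
    have hs : s = 0 := (mul_eq_zero.1 h1).resolve_right hxC
    have h2 := congrArg (fun L => L y) hst
    simp only [_root_.smul_apply, hs, zero_smul, zero_add, hy, smul_eq_mul,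
      mul_one, _root_.zero_apply] at h2
    exact ⟨hs, h2⟩
  · have := (le_derivedDistribution _ _).trans (le_derivedDistribution _ _) hv
    rw [hf.2 θ hθ] at this
    exact this

end Main

theorem mainTheorem8 (W : Set J1) (hW : IsOpen W) (ρ : TwoForm) (hρ : ContDiffOn ℝ ∞ ρ W)
    (hpar : IsParabolic ρ W) (m : ℕ)
    (hrank : ∀ θ ∈ W,
      Module.finrank ℝ (derivedDistribution (characteristicDistribution ρ) θ) = m) :
    (AdmitsIntermediateIntegrals ρ W ↔
      IsIntegrableOn (characteristicDistribution ρ) W ∨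
      IsFourDimIntegrableOn
        (derivedDistribution (derivedDistribution (characteristicDistribution ρ))) W) ∧
    (IsIntegrableOn (characteristicDistribution ρ) W →
      (∀ a ∈ W, ∃ V : Set J1, IsOpen V ∧ a ∈ V ∧ V ⊆ W ∧
        ∃ F, AreIndependentFirstIntegrals (characteristicDistribution ρ) V F) ∧
      ∀ V : Set J1, IsOpen V → V ⊆ W →
        ∀ F, AreIndependentFirstIntegrals (characteristicDistribution ρ) V F →
          ∀ f : J1 → ℝ, IsIntermediateIntegral ρ V f ↔
            IsRegularFunction f V ∧ IsLocallyFunctionOf f F V) ∧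
    (IsFourDimIntegrableOn
        (derivedDistribution (derivedDistribution (characteristicDistribution ρ))) W →
      (∀ a ∈ W, ∃ V : Set J1, IsOpen V ∧ a ∈ V ∧ V ⊆ W ∧
        ∃ f, IsKernelOfDifferential
          (derivedDistribution (derivedDistribution (characteristicDistribution ρ))) V f) ∧
      ∀ V : Set J1, IsOpen V → V ⊆ W →
        ∀ f, IsKernelOfDifferential
          (derivedDistribution (derivedDistribution (characteristicDistribution ρ))) V f →
          IsIntermediateIntegral ρ V f ∧
          ∀ g : J1 → ℝ, IsIntermediateIntegral ρ V g ↔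
            IsRegularFunction g V ∧ IsLocallyFunctionOf g f V) := by
  have hfin := fun η hη => hpar.finrank_characteristicDistribution hW hρ (θ := η) hη
  refine ⟨⟨fun hadm => ?_, ?_⟩, fun hint => ?_, fun h4 => ?_⟩
  · rcases le_or_gt m 2 with hm | hm
    · exact Or.inl (hpar.isIntegrableOn hW hρ fun θ hθ =>
        (Submodule.eq_of_le_of_finrank_le (le_derivedDistribution _ _)
          (by rw [hrank θ hθ, hfin θ hθ]; exact hm)).symm)
    · right
      have key : ∀ {V : Set J1} {f : J1 → ℝ}, IsOpen V → V ⊆ W → IsIntermediateIntegral ρ V f →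
          ∀ θ ∈ V, _ := fun {V f} hV hVW hf θ hθ =>
        hf.derivedDistribution₂_eq hpar hW hρ hV hVW hθ (by rw [hrank θ (hVW hθ)]; exact hm)
      refine ⟨fun a ha => ?_, fun a ha => ?_⟩
      · obtain ⟨V, hV, haV, hVW, f, hf⟩ := hadm a ha
        exact (key hV hVW hf a haV).2
      · obtain ⟨V, hV, haV, hVW, f, hf⟩ := hadm a ha
        refine ⟨V, hV, haV, hVW, 1, fun θ _ => f θ, contDiffOn_pi.2 fun _ => hf.1.1,
          fun θ hθ => ?_⟩
        have hd : HasFDerivAt (fun θ (_ : Fin 1) => f θ)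
            (ContinuousLinearMap.pi fun _ => fderiv ℝ f θ) θ :=
          hasFDerivAt_pi.2 fun _ =>
            ((hf.1.1.contDiffAt (hV.mem_nhds hθ)).differentiableAt (by simp)).hasFDerivAt
        rw [hd.fderiv, (key hV hVW hf θ hθ).1]
        constructor
        · obtain ⟨j, hj⟩ := exists_fderiv_contactFrame_ne_zero (hf.1.2 θ hθ)
          intro y
          refine ⟨(y 0 / fderiv ℝ f θ (contactFrame θ j)) • contactFrame θ j, ?_⟩
          ext k
          fin_cases k
          simp [hj]
        · ext v
          change fderiv ℝ f θ v = 0 ↔ (fun _ : Fin 1 => fderiv ℝ f θ v) = 0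
          exact ⟨fun h => by rw [h]; rfl, fun h => congrFun h 0⟩
  · rintro (hint | h4)
    · exact hpar.admits_of_isIntegrableOn hW hρ hint
    · intro a ha
      obtain ⟨V, hV, haV, hVW, f, hf⟩ := IsFourDimIntegrableOn.exists_isKernelOfDifferential h4 a ha
      exact ⟨V, hV, haV, hVW, f, hpar.isIntermediateIntegral_of_isKernelOfDifferential hW hρ
        hrank h4.1 hV hVW hf⟩
  · exact ⟨hpar.exists_areIndependentFirstIntegrals hW hρ hint, fun V hV hVW F hF f =>
      hpar.isIntermediateIntegral_iff_of_firstIntegrals hW hρ hV hVW hF⟩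
  · refine ⟨IsFourDimIntegrableOn.exists_isKernelOfDifferential h4, fun V hV hVW f hf => ?_⟩
    have hfi := hpar.isIntermediateIntegral_of_isKernelOfDifferential hW hρ hrank h4.1 hV hVW hf
    refine ⟨hfi, fun g => ⟨fun hg => ⟨hg.1, fun a ha => ?_⟩, fun ⟨hg, hloc⟩ => ?_⟩⟩
    · refine exists_eq_comp_of_ker_fderiv_le hV ha hf.1 hg.1.1
        (surjective_fderiv_of_isKernelOfDifferential (fun θ hθ => h4.1 θ (hVW hθ)) hf ha)
        fun θ hθ v hv => hg.fderiv_derivedDistribution₂ hpar hV hVW hθ ?_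
      rw [hf.2 θ hθ]
      exact hv
    · exact hpar.isIntermediateIntegral hW hρ hV hVW hg fun θ hθ v hv =>
        fderiv_eq_zero_of_isLocallyFunctionOf hloc hθ
          ((hf.1.contDiffAt (hV.mem_nhds hθ)).differentiableAt (by simp))
          (hfi.fderiv_eq_zero hpar hV hVW hθ v hv)
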